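/- **Setting.** A *gentle quiver* $(Q,R)$ is a finite quiver $Q=(Q_0,Q_1,s,t)$ with a set $R$ of paths of length two (arrows are composed from left to right) such that every vertex has at most two incoming and at most two outgoing arrows, and for every $q\in Q_1$ there is at most one $r\in Q_1$ with $t(q)=s(r)$, $qr\notin R$; at most one $r$ with $t(q)=s(r)$, $qr\in R$; at most one $r$ with $t(r)=s(q)$, $rq\notin R$; and at most one $r$ with $t(r)=s(q)$, $rq\in R$. A *blossoming* of $(Q,R)$ is a gentle quiver $(Q',R')$ with $Q_0\subseteq Q_0'$, $Q_1\subseteq Q_1'$ (with the same sources and targets) such that: a path $qr$ with $q,r\in Q_1$ is in $R'$ iff it is in $R$; every $q\in Q_1'\setminus Q_1$ has exactly one of $s(q),t(q)$ in $Q_0$; every $i\in Q_0$ is the source of exactly two and the target of exactly two arrows of $Q'$; every $i\in Q_0'\setminus Q_0$ is the source of at most one and the target of at most one arrow of $Q'$; and every length-two path through a vertex of $Q_0'\setminus Q_0$ lies in $R'$. Every gentle quiver has a blossoming. *Walks and strings.* A *letter* is an arrow $q$ of $Q'$ or a formal inverse $q^-$, with $s(q^-)=t(q)$, $t(q^-)=s(q)$.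 A two-letter word is *nonzero* if it is of the form $qr$ or $r^-q^-$ with $t(q)=s(r)$, $qr\notin R'$; or $qr^-$ with $t(q)=t(r)$, $q\neq r$; or $q^-r$ with $s(q)=s(r)$, $q\ne r$. A *walk* is either a *stationary walk*, i.e. a symbol $(q,r)$ with $q,r\in Q'_1$ and $qr$ nonzero, or a nonempty word of letters indexed by a (possibly unbounded) interval of $\mathbb Z$, up to shift of the indices, all of whose two-letter subwords are nonzero. The inverse $\gamma^-$ of a word is the reversed word of inverse letters; the inverse of $(q,r)$ is $(q',r')$ with $q'\neq q$, $t(q')=t(q)$ and $q'r'$ nonzero. A *string* is a pair $\underline\gamma=\{\gamma,\gamma^-\}$ (all inverses that occur below exist). A walk is *left-infinite* if it is a word that is unbounded to the left or whose first letter has its source in $Q_0'\setminus Q_0$; *right-infinite* is defined dually. A walk (and its string) is *infinite* if it is left-infinite and right-infinite, and *confined* if it is neither. Walks $\gamma,\delta$ can be concatenated to $\gamma\delta$ if this is a walk, where a stationary walk $(q,r)$ can be preceded by a walk with last letter $\alpha$ iff $\alpha r$ is nonzero, can be followed by a walk with first letter $\beta$ iff $q\beta$ is nonzero, and disappears in the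 concatenated word. *Factors and torsion sets.* A *factor* of a string $\underline\gamma$ is a string $\underline\omega$ such that, for suitable representatives, $\gamma=\omega$, $\gamma=\gamma_1q^-\omega r\gamma_2$, $\gamma=\gamma_1q^-\omega$ or $\gamma=\omega r\gamma_2$, with $q,r$ arrows of $Q'$ and $\gamma_1,\gamma_2$ possibly empty. If $\gamma,\delta$ are walks and $q\in Q_1$ is an arrow such that $\gamma q\delta$ is a walk, then $\underline{\gamma q\delta}$ is an *extension* of $\underline\gamma$ and $\underline\delta$. A *torsion set* is a set of strings closed under factors and extensions; $\mathsf{tors}(Q,R)$ is the set of torsion sets that consist of confined strings, ordered by inclusion. *Crossings.* For walks $\gamma,\delta$, a *positive crossing* from $\gamma$ to $\delta$ is a pair of decompositions $\gamma=\gamma_1q^-\omega q'\gamma_2$, $\delta=\delta_1r\,\omega\, r'^-\delta_2$ with a common (possibly stationary) walk $\omega$, arrows $q,q',r,r'$ of $Q'$, and $\gamma_1,\gamma_2,\delta_1,\delta_2$ possibly empty. The set of positive crossings from $\underline\gamma$ to $\underline\delta$ is $c^+(\underline\gamma,\underline\delta)=c^+(\gamma,\delta)\sqcup c^+(\gamma,\delta^-)$.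 A set $S$ of strings is *non-crossing* if $c^+(x,y)=\emptyset$ for all $x,y\in S$ (including $x=y$). Let $\mathsf{maxNC}(Q,R)$ be the set of those non-crossing sets of infinite strings that are maximal under inclusion among the non-crossing sets of infinite strings. For a set $S$ of strings let $T(S)$ be the set of confined strings in the smallest torsion set containing $S$. For a confined torsion set $\mathscr T$ let $L(\mathscr T)$ be the set of all strings all of whose confined factors are in $\mathscr T$, and let $$G(\mathscr T)=\{x\in L(\mathscr T)\ \text{infinite}\mid c^+(y,x)=\emptyset\text{ for all }y\in L(\mathscr T)\}.$$ **Theorem.** Let $(Q,R)$ be a gentle quiver and $(Q',R')$ any blossoming of it. (a) The maps $S\mapsto T(S)$ and $\mathscr T\mapsto G(\mathscr T)$ are well-defined, mutually inverse bijections between $\mathsf{maxNC}(Q,R)$ and $\mathsf{tors}(Q,R)$. (b) Let $\geq$ be the partial order on $\mathsf{maxNC}(Q,R)$ induced by this bijection, i.e. $S\geq S'$ iff $T(S')\subseteq T(S)$. Then $S\geq S'$ if and only if $c^+(x,y)=\emptyset$ for all $x\in S'$ and $y\in S$. -/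

import Mathlib

universe u₁ u₂ u₃ u₄

/-- A gentle quiver: a finite quiver with vertex set `V`, arrow set `A`, and a set of quadratic
monomial relations (`rel q r` means that the length-two path `qr`, first `q` then `r`, is a
relation). -/
structure GentleQuiver (V : Type u₁) (A : Type u₂) where
  finite_vertices : Finite V
  finite_arrows : Finite A
  /-- source of an arrow -/
  src : A → V
  /-- target of an arrow -/
  tgt : A → V
  /-- `rel q r` : the path `qr` belongs to the set of relations -/
  rel : A → A → Prop
  rel_composable : ∀ q r, rel q r → tgt q = src r
  two_in : ∀ i : V, {q : A | tgt q = i}.encard ≤ 2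
  two_out : ∀ i : V, {q : A | src q = i}.encard ≤ 2
  nonrel_right : ∀ q r r', tgt q = src r → tgt q = src r' → ¬ rel q r → ¬ rel q r' → r = r'
  rel_right : ∀ q r r', rel q r → rel q r' → r = r'
  nonrel_left : ∀ q r r', tgt r = src q → tgt r' = src q → ¬ rel r q → ¬ rel r' q → r = r'
  rel_left : ∀ q r r', rel r q → rel r' q → r = r'

/-- A presentation of the gentle quiver `Q'` as a blossoming of the gentle quiver `Q`.
The inclusions `Q₀ ⊆ Q'₀` and `Q₁ ⊆ Q'₁` are given by injective maps. -/
structure Blossoming {V : Type u₁} {A : Type u₂} {V' : Type u₃} {A' : Type u₄}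
    (Q : GentleQuiver V A) (Q' : GentleQuiver V' A') where
  vert : V ↪ V'
  arrow : A ↪ A'
  src_arrow : ∀ q, Q'.src (arrow q) = vert (Q.src q)
  tgt_arrow : ∀ q, Q'.tgt (arrow q) = vert (Q.tgt q)
  rel_arrow : ∀ q r, Q'.rel (arrow q) (arrow r) ↔ Q.rel q r
  /-- exactly one end point of a new arrow is an old vertex -/
  new_arrow : ∀ q, q ∉ Set.range arrow →
    Xor (Q'.src q ∈ Set.range vert) (Q'.tgt q ∈ Set.range vert)
  old_out : ∀ i : V, {q : A' | Q'.src q = vert i}.encard = 2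
  old_in : ∀ i : V, {q : A' | Q'.tgt q = vert i}.encard = 2
  /-- every path through a new vertex is a relation -/
  rel_new : ∀ q r, Q'.tgt q = Q'.src r → Q'.src r ∉ Set.range vert → Q'.rel q r
  new_out : ∀ i, i ∉ Set.range vert → {q : A' | Q'.src q = i}.Subsingleton
  new_in : ∀ i, i ∉ Set.range vert → {q : A' | Q'.tgt q = i}.Subsingleton

/-- Letters: arrows and formal inverses of arrows. -/
inductive Letter (A : Type u₂) where
  | arr (q : A) : Letter A
  | inv (q : A) : Letter A

namespace Letter

variable {V : Type u₁} {A : Type u₂}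

/-- The formal inverse of a letter. -/
def flip : Letter A → Letter A
  | arr q => inv q
  | inv q => arr q

theorem flip_flip (α : Letter A) : α.flip.flip = α := by
  cases α <;> rfl

def IsArrow (α : Letter A) : Prop := ∃ q, α = arr q

def IsInverse (α : Letter A) : Prop := ∃ q, α = inv q

def src (Q : GentleQuiver V A) : Letter A → V
  | arr q => Q.src q
  | inv q => Q.tgt q

def tgt (Q : GentleQuiver V A) : Letter A → V
  | arr q => Q.tgt q
  | inv q => Q.src q

/-- `α.Nonzero Q β`: the two-letter word `αβ` is composable and does not vanish. -/
def Nonzero (Q : GentleQuiver V A) : Letter A → Letter A → Prop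
  | arr q, arr r => Q.tgt q = Q.src r ∧ ¬ Q.rel q r
  | inv r, inv q => Q.tgt q = Q.src r ∧ ¬ Q.rel q r
  | arr q, inv r => Q.tgt q = Q.tgt r ∧ q ≠ r
  | inv q, arr r => Q.src q = Q.src r ∧ q ≠ r

end Letter

section Walks

variable {V : Type u₁} {A : Type u₂}

/-- A non-stationary walk: a nonempty word of letters indexed by an interval of `ℤ` (the set of
indices `i` with `letter i ≠ none`), in which no two consecutive letters vanish. -/
structure Word (Q : GentleQuiver V A) where
  letter : ℤ → Option (Letter A)
  nonempty : ∃ i, letter i ≠ none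
  interval : Set.OrdConnected {i | letter i ≠ none}
  nonzero : ∀ i α β, letter i = some α → letter (i + 1) = some β → α.Nonzero Q β

/-- A walk: either a stationary walk, given by two arrows `q`, `r` with `qr` a nonvanishing path,
or a word. -/
inductive Walk (Q : GentleQuiver V A) where
  | stat (q r : A) (h : (Letter.arr q).Nonzero Q (Letter.arr r)) : Walk Q
  | word (w : Word Q) : Walk Q

namespace Walk

variable {Q : GentleQuiver V A}

/-- Two walks are the same, i.e. agree up to a shift of the indices. -/
def Same : Walk Q → Walk Q → Prop
  | stat q r _, stat q' r' _ => q = q' ∧ r = r'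
  | word w, word v => ∃ n : ℤ, ∀ i, v.letter i = w.letter (i + n)
  | _, _ => False

/-- The second walk is the inverse of the first one (up to a shift of the indices). -/
def Inv : Walk Q → Walk Q → Prop
  | stat q _ _, stat q' _ _ => q ≠ q' ∧ Q.tgt q = Q.tgt q'
  | word w, word v => ∃ n : ℤ, ∀ i, v.letter i = (w.letter (n - i)).map Letter.flip
  | _, _ => False

end Walk

/-- Two of three arrows with the same target agree. -/
theorem GentleQuiver.eq_of_ne_of_ne (Q : GentleQuiver V A) {q q' q'' : A} (h : q ≠ q')
    (h' : q' ≠ q'') (e : Q.tgt q = Q.tgt q') (e' : Q.tgt q' = Q.tgt q'') : q = q'' := by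
  by_contra hne
  have hsub : ({q, q', q''} : Set A) ⊆ {x | Q.tgt x = Q.tgt q} := by
    rintro x (rfl | rfl | rfl)
    · rfl
    · exact e.symm
    · exact (e.trans e').symm
  have h3 : ({q, q', q''} : Set A).encard = 3 := Set.encard_eq_three.2 ⟨q, q', q'', h, hne, h', rfl⟩
  have := (Set.encard_le_encard hsub).trans (Q.two_in _)
  rw [h3] at this
  exact absurd this (by decide)

/-- Walks up to shift of indices and inversion. -/
def walkSetoid (Q : GentleQuiver V A) : Setoid (Walk Q) where
  r γ δ := γ.Same δ ∨ γ.Inv δ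
  iseqv := by
    refine ⟨?_, ?_, ?_⟩
    · rintro (⟨q, r, h⟩ | w)
      · exact Or.inl ⟨rfl, rfl⟩
      · exact Or.inl ⟨0, fun i => by simp⟩
    · rintro (⟨q, r, h⟩ | w) (⟨q', r', h'⟩ | v) (H | H)
      · exact Or.inl ⟨H.1.symm, H.2.symm⟩
      · exact Or.inr ⟨H.1.symm, H.2.symm⟩
      · exact H.elim
      · exact H.elim
      · exact H.elim
      · exact H.elim
      · obtain ⟨n, hn⟩ := H
        exact Or.inl ⟨-n, fun i => by rw [hn]; simp⟩
      · obtain ⟨n, hn⟩ := H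
        refine Or.inr ⟨n, fun i => ?_⟩
        rw [hn]
        have : Letter.flip ∘ Letter.flip = (id : Letter A → Letter A) :=
          funext Letter.flip_flip
        simp [this]
    · rintro (⟨q, r, h⟩ | w) (⟨q', r', h'⟩ | v) (⟨q'', r'', h''⟩ | x) (H | H) (K | K) <;>
        try first | exact H.elim | exact K.elim
      · exact Or.inl ⟨H.1.trans K.1, H.2.trans K.2⟩
      · obtain ⟨rfl, rfl⟩ := H
        exact Or.inr K
      · obtain ⟨rfl, rfl⟩ := K
        exact Or.inr H
      · have e := Q.eq_of_ne_of_ne H.1 K.1 H.2 K.2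
        subst e
        exact Or.inl ⟨rfl, Q.nonrel_right _ _ _ h.1 h''.1 h.2 h''.2⟩
      · obtain ⟨n, hn⟩ := H
        obtain ⟨m, hm⟩ := K
        exact Or.inl ⟨m + n, fun i => by rw [hm, hn, add_assoc]⟩
      · obtain ⟨n, hn⟩ := H
        obtain ⟨m, hm⟩ := K
        exact Or.inr ⟨m + n, fun i => by rw [hm, hn]; congr 2; ring⟩
      · obtain ⟨n, hn⟩ := H
        obtain ⟨m, hm⟩ := K
        exact Or.inr ⟨n - m, fun i => by rw [hm, hn]; congr 2; ring⟩
      · obtain ⟨n, hn⟩ := H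
        obtain ⟨m, hm⟩ := K
        refine Or.inl ⟨n - m, fun i => ?_⟩
        have : Letter.flip ∘ Letter.flip = (id : Letter A → Letter A) :=
          funext Letter.flip_flip
        rw [hm, hn]
        simp only [Option.map_map, this, Option.map_id, id]
        congr 1; ring

/-- Strings: a string is a walk considered up to inversion. -/
def Str (Q : GentleQuiver V A) : Type u₂ := Quotient (walkSetoid Q)

/-- The string of a walk. -/
def Walk.str {Q : GentleQuiver V A} (γ : Walk Q) : Str Q := Quotient.mk (walkSetoid Q) γ

namespace Word

variable {Q : GentleQuiver V A}

/-- `w.OccursAt a b ω`: the walk `ω` is the subwalk of `w` that consists of the letters with index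
`i`, `a ≤ i < b`; here `a = none` and `b = none` mean that there is no bound. When `a = b = k` this
is a stationary walk `ω = (q, r)` placed at the cut just before the index `k` (which is an interior
cut or an end of `w`); for it to be concatenable with the adjacent letters, `αr` has to be
nonvanishing for the letter `α` before the cut and `qβ` for the letter `β` after the cut. -/
def OccursAt (w : Word Q) (a b : Option ℤ) : Walk Q → Prop
  | .word v => ∃ m : ℤ, ∀ i α, v.letter i = some α ↔
      w.letter (i + m) = some α ∧ (∀ k ∈ a, k ≤ i + m) ∧ (∀ k ∈ b, i + m < k)
  | .stat q r _ => ∃ k : ℤ, a = some k ∧ b = some k ∧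
      (w.letter (k - 1) ≠ none ∨ w.letter k ≠ none) ∧
      (∀ α ∈ w.letter (k - 1), α.Nonzero Q (Letter.arr r)) ∧
      (∀ β ∈ w.letter k, (Letter.arr q).Nonzero Q β)

/-- The letter of `w` just before the cut `a`, if there is one. -/
def before (w : Word Q) (a : Option ℤ) : Option (Letter A) := a.bind fun k => w.letter (k - 1)

/-- The letter of `w` just after the cut `b`, if there is one. -/
def after (w : Word Q) (b : Option ℤ) : Option (Letter A) := b.bind fun k => w.letter k

/-- There is a positive crossing from `w` to `v`: a walk `ω` and decompositions
`w = w₁ q⁻ ω q' w₂` and `v = v₁ r ω r'⁻ v₂` with arrows `q`, `q'`, `r`, `r'`, where `w₁`, `w₂`, `v₁`,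
`v₂` may be empty. (The common subwalk `ω` is then automatically maximal.) -/
def PosCross (w v : Word Q) : Prop :=
  ∃ (ω : Walk Q) (a b c d : Option ℤ) (q q' r r' : A),
    w.OccursAt a b ω ∧ w.before a = some (Letter.inv q) ∧ w.after b = some (Letter.arr q') ∧
    v.OccursAt c d ω ∧ v.before c = some (Letter.arr r) ∧ v.after d = some (Letter.inv r')

end Word

namespace Str

variable {Q : GentleQuiver V A}

/-- `y.IsFactor x`: the string `y` is a factor of the string `x`, i.e. `x = y`, or `x` and `y` are
the strings of walks `γ`, `ω` with `γ = γ₁ q⁻ ω r γ₂`, or `γ = γ₁ q⁻ ω`, or `γ = ω r γ₂`, where `q`,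
`r` are arrows and `γ₁`, `γ₂` may be empty. -/
def IsFactor (y x : Str Q) : Prop :=
  x = y ∨ ∃ (w : Word Q) (ω : Walk Q) (a b : Option ℤ),
    (Walk.word w).str = x ∧ ω.str = y ∧ w.OccursAt a b ω ∧
    (∀ α ∈ w.before a, α.IsInverse) ∧ (∀ β ∈ w.after b, β.IsArrow)

/-- There is a positive crossing from the string `x` to the string `y`. -/
def PosCross (x y : Str Q) : Prop :=
  ∃ w v : Word Q, (Walk.word w).str = x ∧ (Walk.word v).str = y ∧ w.PosCross v

end Str

/-- A set of strings is non-crossing. -/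
def NonCrossing {Q : GentleQuiver V A} (S : Set (Str Q)) : Prop :=
  ∀ x ∈ S, ∀ y ∈ S, ¬ x.PosCross y

end Walks

namespace Blossoming

variable {V : Type u₁} {A : Type u₂} {V' : Type u₃} {A' : Type u₄}
  {Q : GentleQuiver V A} {Q' : GentleQuiver V' A'}

/-- Left-infinite walks: left-unbounded, or starting at a new vertex. -/
def LeftInfinite (B : Blossoming Q Q') : Walk Q' → Prop
  | .stat _ _ _ => False
  | .word w => (¬ BddBelow {i | w.letter i ≠ none}) ∨
      ∃ i α, w.letter i = some α ∧ w.letter (i - 1) = none ∧ α.src Q' ∉ Set.range B.vert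

/-- Right-infinite walks: right-unbounded, or ending at a new vertex. -/
def RightInfinite (B : Blossoming Q Q') : Walk Q' → Prop
  | .stat _ _ _ => False
  | .word w => (¬ BddAbove {i | w.letter i ≠ none}) ∨
      ∃ i α, w.letter i = some α ∧ w.letter (i + 1) = none ∧ α.tgt Q' ∉ Set.range B.vert

/-- Infinite strings. -/
def IsInfinite (B : Blossoming Q Q') (x : Str Q') : Prop :=
  ∃ γ : Walk Q', γ.str = x ∧ B.LeftInfinite γ ∧ B.RightInfinite γ

/-- Confined strings. -/
def IsConfined (B : Blossoming Q Q') (x : Str Q') : Prop :=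
  ∃ γ : Walk Q', γ.str = x ∧ ¬ B.LeftInfinite γ ∧ ¬ B.RightInfinite γ

/-- The string `z` is an extension of the strings `x` and `y`: `z` is the string of a walk `γ q δ`
where `q` is an arrow of `Q` and `γ`, `δ` are walks with strings `x`, `y`. -/
def IsExtension (B : Blossoming Q Q') (x y z : Str Q') : Prop :=
  ∃ (w : Word Q') (k : ℤ) (q : A) (γ δ : Walk Q') (a b : Option ℤ),
    (Walk.word w).str = z ∧ γ.str = x ∧ δ.str = y ∧
    w.letter k = some (Letter.arr (B.arrow q)) ∧
    w.OccursAt a (some k) γ ∧ w.before a = none ∧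
    w.OccursAt (some (k + 1)) b δ ∧ w.after b = none

/-- Torsion sets: sets of strings closed under factors and extensions. -/
def IsTorsionSet (B : Blossoming Q Q') (T : Set (Str Q')) : Prop :=
  (∀ x ∈ T, ∀ y, y.IsFactor x → y ∈ T) ∧
  (∀ x ∈ T, ∀ y ∈ T, ∀ z, B.IsExtension x y z → z ∈ T)

/-- The set of confined torsion sets. -/
def tors (B : Blossoming Q Q') : Set (Set (Str Q')) :=
  {T | B.IsTorsionSet T ∧ ∀ x ∈ T, B.IsConfined x}

/-- The set of maximal non-crossing sets of infinite strings. -/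
def maxNC (B : Blossoming Q Q') : Set (Set (Str Q')) :=
  {S | Maximal (fun S : Set (Str Q') => (∀ x ∈ S, B.IsInfinite x) ∧ NonCrossing S) S}

/-- The confined part of a set of strings. -/
def fin (B : Blossoming Q Q') (S : Set (Str Q')) : Set (Str Q') := {x ∈ S | B.IsConfined x}

/-- The smallest torsion set containing a set of strings. -/
def torsInf (B : Blossoming Q Q') (S : Set (Str Q')) : Set (Str Q') :=
  ⋂₀ {T | B.IsTorsionSet T ∧ S ⊆ T}

/-- The confined torsion set `T(S)` generated by a set of strings. -/
def torsGen (B : Blossoming Q Q') (S : Set (Str Q')) : Set (Str Q') := B.fin (B.torsInf S)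

/-- The set `L(T)` of all strings whose confined factors belong to `T`. -/
def lift (B : Blossoming Q Q') (T : Set (Str Q')) : Set (Str Q') :=
  {x | B.fin {y | y.IsFactor x} ⊆ T}

/-- The set `G(T)` of all infinite strings in `L(T)` that receive no positive crossing from a
string in `L(T)`. -/
def gen (B : Blossoming Q Q') (T : Set (Str Q')) : Set (Str Q') :=
  {x ∈ B.lift T | B.IsInfinite x ∧ ∀ y ∈ B.lift T, ¬ y.PosCross x}

end Blossoming

/-- Every gentle quiver has a blossoming. -/
theorem GentleQuiver.exists_blossoming {V : Type u₁} {A : Type u₂} (Q : GentleQuiver V A) :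
    ∃ (V' : Type u₁) (A' : Type (max u₁ u₂)) (Q' : GentleQuiver V' A'),
      Nonempty (Blossoming Q Q') := by
  classical
  have := Q.finite_vertices
  have := Q.finite_arrows
  have two : ∀ (s : Set A), s.encard ≤ 2 → ∀ a b c, a ∈ s → b ∈ s → c ∈ s → a ≠ b → a ≠ c →
      b = c := by
    intro s hs a b c ha hb hc hab hac
    by_contra hbc
    have hsub : ({a, b, c} : Set A) ⊆ s := by
      rintro x (rfl | rfl | rfl) <;> assumption
    have h3 : ({a, b, c} : Set A).encard = 3 := Set.encard_eq_three.2 ⟨a, b, c, hab, hac, hbc, rfl⟩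
    have := (Set.encard_le_encard hsub).trans hs
    rw [h3] at this
    exact absurd this (by decide)
  -- labels of the heads and tails of arrows
  have key : ∀ i : V, ∃ h t : A → Bool,
      (∀ a b, Q.tgt a = i → Q.tgt b = i → h a = h b → a = b) ∧
      (∀ a b, Q.src a = i → Q.src b = i → t a = t b → a = b) ∧
      (∀ a c, Q.tgt a = i → Q.src c = i → (Q.rel a c ↔ h a = t c)) := by
    intro i
    by_cases hin : ∃ a, Q.tgt a = i
    · obtain ⟨a₀, ha₀⟩ := hin
      refine ⟨fun a => decide (a = a₀), fun c => decide (Q.rel a₀ c), ?_, ?_, ?_⟩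
      · intro a b ha hb e
        simp only [decide_eq_decide] at e
        by_cases h : a = a₀
        · rw [h, e.1 h]
        · exact two _ (Q.two_in i) a₀ a b ha₀ ha hb (Ne.symm h) fun h' => h (e.2 h'.symm)
      · intro a b ha hb e
        simp only [decide_eq_decide] at e
        by_cases h : Q.rel a₀ a
        · exact Q.rel_right _ _ _ h (e.1 h)
        · exact Q.nonrel_right a₀ _ _ (ha₀.trans ha.symm) (ha₀.trans hb.symm) h
            fun h' => h (e.2 h')
      · intro a c ha hc
        simp only [decide_eq_decide]
        by_cases h : a = a₀
        · subst h; simp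
        · simp only [h, false_iff]
          constructor
          · intro h1 h2
            exact h (Q.rel_left _ _ _ h1 h2)
          · intro h1
            by_contra h2
            exact h (Q.nonrel_left _ _ _ (ha.trans hc.symm) (ha₀.trans hc.symm) h2 h1)
    · by_cases hout : ∃ c, Q.src c = i
      · obtain ⟨c₀, hc₀⟩ := hout
        refine ⟨fun _ => true, fun c => decide (c = c₀), ?_, ?_, ?_⟩
        · intro a b ha; exact (hin ⟨a, ha⟩).elim
        · intro a b ha hb e
          simp only [decide_eq_decide] at e
          by_cases h : a = c₀
          · rw [h, e.1 h]
          · exact two _ (Q.two_out i) c₀ a b hc₀ ha hb (Ne.symm h) fun h' => h (e.2 h'.symm)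
        · intro a c ha; exact (hin ⟨a, ha⟩).elim
      · exact ⟨fun _ => true, fun _ => true, fun a b ha => (hin ⟨a, ha⟩).elim,
          fun a b ha => (hout ⟨a, ha⟩).elim, fun a b ha => (hin ⟨a, ha⟩).elim⟩
  choose h t hh ht hht using key
  -- new incoming and outgoing arrows: the missing labels
  let NI := {p : V × Bool // ∀ a, Q.tgt a = p.1 → h p.1 a ≠ p.2}
  let NO := {p : V × Bool // ∀ a, Q.src a = p.1 → t p.1 a ≠ p.2}
  let A' := A ⊕ (NI ⊕ NO)
  let V' := V ⊕ (NI ⊕ NO)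
  let s' : A' → V' := fun x => match x with
    | .inl a => .inl (Q.src a)
    | .inr (.inl p) => .inr (.inl p)
    | .inr (.inr p) => .inl p.1.1
  let t' : A' → V' := fun x => match x with
    | .inl a => .inl (Q.tgt a)
    | .inr (.inl p) => .inl p.1.1
    | .inr (.inr p) => .inr (.inr p)
  let H : A' → Bool := fun x => match x with
    | .inl a => h (Q.tgt a) a
    | .inr (.inl p) => p.1.2
    | .inr (.inr _) => true
  let T : A' → Bool := fun x => match x with
    | .inl a => t (Q.src a) a
    | .inr (.inl _) => true
    | .inr (.inr p) => p.1.2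
  have injH : ∀ x y, t' x = t' y → H x = H y → x = y := by
    rintro (a | p | p) (b | q | q) e e' <;> simp only [t', H, reduceCtorEq] at e e'
    · have e := Sum.inl.inj e
      exact congrArg _ (hh _ a b rfl e.symm (by rw [e', e]))
    · have e := Sum.inl.inj e
      exact (q.2 a e (by rw [← e, e'])).elim
    · have e := Sum.inl.inj e
      exact (p.2 b e.symm (by rw [e', e])).elim
    · have e : p = q := Subtype.ext (Prod.ext (Sum.inl.inj e) e')
      rw [e]
    · cases e
      rfl
  have injT : ∀ x y, s' x = s' y → T x = T y → x = y := by
    rintro (a | p | p) (b | q | q) e e' <;> simp only [s', T, reduceCtorEq] at e e'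
    · have e := Sum.inl.inj e
      exact congrArg _ (ht _ a b rfl e.symm (by rw [e', e]))
    · have e := Sum.inl.inj e
      exact (q.2 a e (by rw [← e, e'])).elim
    · cases e
      rfl
    · have e := Sum.inl.inj e
      exact (p.2 b e.symm (by rw [e', e])).elim
    · have e : p = q := Subtype.ext (Prod.ext (Sum.inl.inj e) e')
      rw [e]
  have exH : ∀ (i : V) (b : Bool), ∃ x, t' x = .inl i ∧ H x = b := by
    intro i b
    by_cases hx : ∃ a, Q.tgt a = i ∧ h i a = b
    · obtain ⟨a, rfl, ha⟩ := hx
      exact ⟨.inl a, rfl, ha⟩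
    · push Not at hx
      exact ⟨.inr (.inl ⟨(i, b), hx⟩), rfl, rfl⟩
  have exT : ∀ (i : V) (b : Bool), ∃ x, s' x = .inl i ∧ T x = b := by
    intro i b
    by_cases hx : ∃ a, Q.src a = i ∧ t i a = b
    · obtain ⟨a, rfl, ha⟩ := hx
      exact ⟨.inl a, rfl, ha⟩
    · push Not at hx
      exact ⟨.inr (.inr ⟨(i, b), hx⟩), rfl, rfl⟩
  have le2 : ∀ (s : Set A') (f : A' → Bool), (∀ x ∈ s, ∀ y ∈ s, f x = f y → x = y) →
      s.encard ≤ 2 := by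
    intro s f hf
    rw [← Set.InjOn.encard_image (f := f) (s := s) fun x hx y hy => hf x hx y hy]
    refine (Set.encard_le_encard (Set.subset_univ _)).trans ?_
    rw [Set.encard_univ]
    simp
  have eq2 : ∀ (s : Set A') (f : A' → Bool), (∀ x ∈ s, ∀ y ∈ s, f x = f y → x = y) →
      (∀ b, ∃ x ∈ s, f x = b) → s.encard = 2 := by
    intro s f hf hs
    rw [← Set.InjOn.encard_image (f := f) (s := s) fun x hx y hy => hf x hx y hy]
    have : f '' s = Set.univ := Set.eq_univ_of_forall hs
    rw [this, Set.encard_univ]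
    simp
  have bool3 : ∀ a b c : Bool, a ≠ b → a ≠ c → b = c := by decide
  let Q' : GentleQuiver V' A' :=
    { finite_vertices := inferInstance
      finite_arrows := inferInstance
      src := s'
      tgt := t'
      rel := fun x y => t' x = s' y ∧ H x = T y
      rel_composable := fun x y e => e.1
      two_in := fun i => le2 _ H fun x hx y hy => injH x y (hx.trans hy.symm)
      two_out := fun i => le2 _ T fun x hx y hy => injT x y (hx.trans hy.symm)
      nonrel_right := fun q r r' e e' n n' => injT r r' (e.symm.trans e')
        (bool3 _ _ _ (fun k => n ⟨e, k⟩) (fun k => n' ⟨e', k⟩))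
      rel_right := fun q r r' e e' => injT r r' (e.1.symm.trans e'.1) (e.2.symm.trans e'.2)
      nonrel_left := fun q r r' e e' n n' => injH r r' (e.trans e'.symm)
        (bool3 _ _ _ (fun k => n ⟨e, k.symm⟩) (fun k => n' ⟨e', k.symm⟩))
      rel_left := fun q r r' e e' => injH r r' (e.1.trans e'.1.symm) (e.2.trans e'.2.symm) }
  refine ⟨V', A', Q', ⟨{ vert := ⟨Sum.inl, Sum.inl_injective⟩, arrow := ⟨Sum.inl, Sum.inl_injective⟩
                         src_arrow := fun _ => rfl, tgt_arrow := fun _ => rfl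
                         rel_arrow := ?_, new_arrow := ?_, old_out := ?_, old_in := ?_
                         rel_new := ?_, new_out := ?_, new_in := ?_ }⟩⟩
  · intro q r
    simp only [Q', t', s', H, T, Function.Embedding.coeFn_mk]
    constructor
    · rintro ⟨e, e'⟩
      have e := Sum.inl.inj e
      exact (hht _ q r e rfl).2 (by rw [← e', e])
    · intro hr
      have e := Q.rel_composable _ _ hr
      exact ⟨congrArg _ e, by rw [e]; exact (hht _ q r e rfl).1 hr⟩
  · rintro (a | p | p) hq
    · exact (hq ⟨a, rfl⟩).elim
    · exact Or.inr ⟨⟨p.1.1, rfl⟩, by rintro ⟨x, hx⟩; cases hx⟩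
    · exact Or.inl ⟨⟨p.1.1, rfl⟩, by rintro ⟨x, hx⟩; cases hx⟩
  · intro i
    exact eq2 _ T (fun x hx y hy => injT x y (hx.trans hy.symm)) (exT i)
  · intro i
    exact eq2 _ H (fun x hx y hy => injH x y (hx.trans hy.symm)) (exH i)
  · rintro (a | p | p) (b | q | q) e hn
    · exact (hn ⟨_, rfl⟩).elim
    · cases e
    · exact (hn ⟨_, rfl⟩).elim
    · exact (hn ⟨_, rfl⟩).elim
    · cases e
    · exact (hn ⟨_, rfl⟩).elim
    · cases e
    · cases e
    · exact (hn ⟨_, rfl⟩).elim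
  · rintro (i | i | i) hi
    · exact (hi ⟨i, rfl⟩).elim
    · rintro (a | p | p) hx (b | q | q) hy <;> cases hx <;> cases hy; rfl
    · rintro (a | p | p) hx <;> cases hx
  · rintro (i | i | i) hi
    · exact (hi ⟨i, rfl⟩).elim
    · rintro (a | p | p) hx <;> cases hx
    · rintro (a | p | p) hx (b | q | q) hy <;> cases hx <;> cases hy; rfl

/-!
All notions are translated into the segments of words between two cuts at old vertices. Here
`B.Seg w a b x` says that `x` is the string of the part of the word `w` between the cuts `a ≤ b`,
which is stationary if `a = b`. Such strings are exactly the confined ones that occur in `w`. A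
confined string `t` is an *inner factor* of `x` if `x = γ₁ q⁻ t r γ₂`, and an *inner subobject* of
`x` if `x = γ₁ q t r⁻ γ₂`, with arrows `q`, `r`. A positive crossing from `x` to `y` is an inner
factor of `x` that is an inner subobject of `y` (`posCross_iff`), and an infinite string `x` lies in
`L(T)` if and only if its inner factors belong to `T` (`mem_lift_iff_of_isInfinite`).

Two torsion sets carry the argument. First, `L(T)` is a torsion set, so that `T(S) ⊆ T` if and
only if `S ⊆ L(T)` (`torsGen_subset_iff`). Second, the confined strings without a factor that is
an inner subobject of a given infinite string `x` form a torsion set (`subFree_mem_tors`); hence,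
if no string in `S` has a positive crossing to `x`, then no string generated by `S` has one.

The main construction (`exists_completion`) completes a segment to an infinite word. At an old
vertex a word can be continued by exactly one arrow and by exactly one inverse arrow. To the right
an arrow, and to the left an inverse arrow, is chosen whenever this does not create a factor
outside `T`. The resulting string lies in `L(T)`, and none of its inner subobjects belongs to `T`,
except possibly some inside the given segment. It follows (`mem_gen_iff`) that `G(T)` consists of
the infinite strings whose inner factors belong to `T` and whose inner subobjects do not.

* If `x` is infinite and not in `L(T)`, completing a shortest inner factor of `x` outside `T`
  yields a string in `G(T)` to which `x` has a positive crossing (`exists_posCross_gen`).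
* If `x` is infinite, in `L(T)` but not in `G(T)`, completing a shortest inner subobject of `x` in
  `T` yields a string in `G(T)` with a positive crossing to `x` (`exists_gen_posCross`).

So `G(T)` is a maximal non-crossing set. The first of these facts also gives `T(G(T)) = T` and the
description of the order, and the second torsion set gives `S ⊆ G(T(S))`, hence equality by
maximality.
-/

/-! ### Letters -/

namespace Letter

variable {V : Type u₁} {A : Type u₂} {Q : GentleQuiver V A}

theorem isArrow_flip {α : Letter A} : α.flip.IsArrow ↔ α.IsInverse := by
  cases α <;> simp [flip, IsArrow, IsInverse]

theorem isInverse_flip {α : Letter A} : α.flip.IsInverse ↔ α.IsArrow := by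
  cases α <;> simp [flip, IsArrow, IsInverse]

theorem src_flip (α : Letter A) : α.flip.src Q = α.tgt Q := by cases α <;> rfl

theorem tgt_flip (α : Letter A) : α.flip.tgt Q = α.src Q := by cases α <;> rfl

theorem Nonzero.flip {α β : Letter A} (h : α.Nonzero Q β) : β.flip.Nonzero Q α.flip := by
  cases α <;> cases β
  · exact h
  · exact ⟨h.1.symm, h.2.symm⟩
  · exact ⟨h.1.symm, h.2.symm⟩
  · exact h

theorem Nonzero.tgt_eq {α β : Letter A} (h : α.Nonzero Q β) : α.tgt Q = β.src Q := by
  cases α <;> cases β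
  · exact h.1
  · exact h.1
  · exact h.1
  · exact h.1.symm

/-- Two of three arrows with the same source agree. -/
theorem _root_.GentleQuiver.eq_of_ne_of_ne_src (Q : GentleQuiver V A) {q q' q'' : A} (h : q ≠ q')
    (h' : q' ≠ q'') (e : Q.src q = Q.src q') (e' : Q.src q' = Q.src q'') : q = q'' := by
  by_contra hne
  have hsub : ({q, q', q''} : Set A) ⊆ {x | Q.src x = Q.src q} := by
    rintro x (rfl | rfl | rfl)
    · rfl
    · exact e.symm
    · exact (e.trans e').symm
  have h3 : ({q, q', q''} : Set A).encard = 3 := Set.encard_eq_three.2 ⟨q, q', q'', h, hne, h', rfl⟩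
  have := (Set.encard_le_encard hsub).trans (Q.two_out _)
  rw [h3] at this
  exact absurd this (by decide)

theorem Nonzero.arr_unique {α : Letter A} {r r' : A} (h : α.Nonzero Q (arr r))
    (h' : α.Nonzero Q (arr r')) : r = r' := by
  cases α with
  | arr q => exact Q.nonrel_right q r r' h.1 h'.1 h.2 h'.2
  | inv q => exact Q.eq_of_ne_of_ne_src h.2.symm h'.2 h.1.symm h'.1

theorem Nonzero.inv_unique {α : Letter A} {r r' : A} (h : α.Nonzero Q (inv r))
    (h' : α.Nonzero Q (inv r')) : r = r' := by
  cases α with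
  | arr q => exact Q.eq_of_ne_of_ne h.2.symm h'.2 h.1.symm h'.1
  | inv q => exact Q.nonrel_left q r r' h.1 h'.1 h.2 h'.2

/-- If the stationary walk `(q, r)` can be preceded by the letter `α`, then it can be followed by
every letter that can follow `α`. -/
theorem Nonzero.of_left {α β : Letter A} {q r : A} (hαr : α.Nonzero Q (arr r))
    (hqr : (arr q).Nonzero Q (arr r)) (h : α.Nonzero Q β) : (arr q).Nonzero Q β := by
  cases α with
  | arr a =>
    rwa [Q.nonrel_left r q a hqr.1 hαr.1 hqr.2 hαr.2]
  | inv a =>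
    cases β with
    | arr b => rwa [h.arr_unique hαr]
    | inv b =>
      refine ⟨hqr.1.trans (hαr.1.symm.trans h.1.symm), fun e => hαr.2 ?_⟩
      subst e
      exact Q.nonrel_right q a r h.1 hqr.1 h.2 hqr.2

/-- If the stationary walk `(q, r)` can be followed by the letter `β`, then it can be preceded by
every letter that can precede `β`. -/
theorem Nonzero.of_right {α β : Letter A} {q r : A} (hqβ : (arr q).Nonzero Q β)
    (hqr : (arr q).Nonzero Q (arr r)) (h : α.Nonzero Q β) : α.Nonzero Q (arr r) := by
  cases β with
  | arr b => rwa [hqr.arr_unique hqβ]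
  | inv b =>
    cases α with
    | arr a => rwa [Q.eq_of_ne_of_ne h.2 hqβ.2.symm h.1 hqβ.1.symm]
    | inv a =>
      refine ⟨h.1.symm.trans (hqβ.1.symm.trans hqr.1), fun e => hqβ.2 ?_⟩
      subst e
      exact Q.nonrel_left a q b hqr.1 h.1 hqr.2 h.2

/-- The letters adjacent to the stationary walk `(q, r)` are, after inversion, adjacent to the
inverse stationary walk `(q', r')`. -/
theorem Nonzero.stat_inv_left {β : Letter A} {q r q' r' : A} (hq : q ≠ q')
    (ht : Q.tgt q = Q.tgt q') (h : (arr q).Nonzero Q (arr r)) (h' : (arr q').Nonzero Q (arr r'))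
    (hβ : (arr q).Nonzero Q β) : β.flip.Nonzero Q (arr r') := by
  have h1 : (inv r).Nonzero Q (arr r') := by
    refine ⟨h.1.symm.trans (ht.trans h'.1), fun e => hq ?_⟩
    subst e
    exact Q.nonrel_left r q q' h.1 h'.1 h.2 h'.2
  cases β with
  | arr b => rwa [hβ.arr_unique h]
  | inv b =>
    have : b = q' := Q.eq_of_ne_of_ne hβ.2.symm hq hβ.1.symm ht
    rwa [this]

theorem Nonzero.stat_inv_right {α : Letter A} {q r q' r' : A} (hq : q ≠ q')
    (ht : Q.tgt q = Q.tgt q') (h : (arr q).Nonzero Q (arr r)) (h' : (arr q').Nonzero Q (arr r'))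
    (hα : α.Nonzero Q (arr r)) : (arr q').Nonzero Q α.flip := by
  cases α with
  | arr a =>
    rw [Q.nonrel_left r a q hα.1 h.1 hα.2 h.2]
    exact ⟨ht.symm, hq.symm⟩
  | inv a =>
    have hr : r ≠ r' := by
      intro e
      subst e
      exact hq (Q.nonrel_left r q q' h.1 h'.1 h.2 h'.2)
    rwa [Q.eq_of_ne_of_ne_src hα.2 hr hα.1 (h.1.symm.trans (ht.trans h'.1))]

end Letter

namespace Blossoming

variable {V : Type u₁} {A : Type u₂} {V' : Type u₃} {A' : Type u₄}
  {Q : GentleQuiver V A} {Q' : GentleQuiver V' A'}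

theorem tgt_mem_of_nonzero (B : Blossoming Q Q') {α β : Letter A'} (h : α.Nonzero Q' β) :
    α.tgt Q' ∈ Set.range B.vert := by
  by_contra hn
  cases α with
  | arr a =>
    cases β with
    | arr b => exact h.2 (B.rel_new a b h.1 (h.1 ▸ hn))
    | inv b => exact h.2 (B.new_in _ hn rfl h.1.symm)
  | inv a =>
    cases β with
    | arr b => exact h.2 (B.new_out _ hn rfl h.1.symm)
    | inv b => exact h.2 (B.rel_new b a h.1 hn)

theorem src_mem_of_nonzero (B : Blossoming Q Q') {α β : Letter A'} (h : α.Nonzero Q' β) :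
    β.src Q' ∈ Set.range B.vert :=
  h.tgt_eq ▸ B.tgt_mem_of_nonzero h

theorem exists_ne_of_encard_eq_two {X : Type*} {s : Set X} (h : s.encard = 2) (x : X) :
    ∃ y ∈ s, x ≠ y := by
  obtain ⟨a, b, hab, rfl⟩ := Set.encard_eq_two.1 h
  by_cases hx : x = a
  · exact ⟨b, by simp, hx ▸ hab⟩
  · exact ⟨a, by simp, hx⟩

theorem exists_nonzero_arr (B : Blossoming Q Q') {α : Letter A'}
    (h : α.tgt Q' ∈ Set.range B.vert) : ∃ r, α.Nonzero Q' (Letter.arr r) := by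
  obtain ⟨i, hi⟩ := h
  cases α with
  | arr a =>
    by_contra! hn
    obtain ⟨x, y, hxy, hs⟩ := Set.encard_eq_two.1 (B.old_out i)
    have hx : Q'.src x = B.vert i := hs.symm.subset (by simp : x ∈ ({x, y} : Set A'))
    have hy : Q'.src y = B.vert i := hs.symm.subset (by simp : y ∈ ({x, y} : Set A'))
    refine hxy (Q'.rel_right a x y (not_not.1 fun k => hn x ⟨?_, k⟩)
      (not_not.1 fun k => hn y ⟨?_, k⟩))
    · exact hi.symm.trans hx.symm
    · exact hi.symm.trans hy.symm
  | inv a =>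
    obtain ⟨y, hy, hne⟩ := exists_ne_of_encard_eq_two (B.old_out i) a
    exact ⟨y, hi.symm.trans hy.symm, hne⟩

theorem exists_nonzero_inv (B : Blossoming Q Q') {α : Letter A'}
    (h : α.tgt Q' ∈ Set.range B.vert) : ∃ r, α.Nonzero Q' (Letter.inv r) := by
  obtain ⟨i, hi⟩ := h
  cases α with
  | inv a =>
    by_contra! hn
    obtain ⟨x, y, hxy, hs⟩ := Set.encard_eq_two.1 (B.old_in i)
    have hx : Q'.tgt x = B.vert i := hs.symm.subset (by simp : x ∈ ({x, y} : Set A'))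
    have hy : Q'.tgt y = B.vert i := hs.symm.subset (by simp : y ∈ ({x, y} : Set A'))
    refine hxy (Q'.rel_left a x y (not_not.1 fun k => hn x ⟨?_, k⟩)
      (not_not.1 fun k => hn y ⟨?_, k⟩))
    · exact hx.trans hi
    · exact hy.trans hi
  | arr a =>
    obtain ⟨y, hy, hne⟩ := exists_ne_of_encard_eq_two (B.old_in i) a
    exact ⟨y, hi.symm.trans hy.symm, hne⟩

/-- Every letter that ends at an old vertex can be followed by a stationary walk. -/
theorem exists_stat_right (B : Blossoming Q Q') {α : Letter A'}
    (h : α.tgt Q' ∈ Set.range B.vert) :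
    ∃ q r, (Letter.arr q).Nonzero Q' (Letter.arr r) ∧ α.Nonzero Q' (Letter.arr r) := by
  obtain ⟨r, hr⟩ := B.exists_nonzero_arr h
  obtain ⟨q, hq⟩ := B.exists_nonzero_inv (α := Letter.inv r) (B.src_mem_of_nonzero hr)
  exact ⟨q, r, hq, hr⟩

/-- Every letter that starts at an old vertex can be preceded by a stationary walk. -/
theorem exists_stat_left (B : Blossoming Q Q') {β : Letter A'}
    (h : β.src Q' ∈ Set.range B.vert) :
    ∃ q r, (Letter.arr q).Nonzero Q' (Letter.arr r) ∧ (Letter.arr q).Nonzero Q' β := by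
  obtain ⟨q, hq⟩ := B.exists_nonzero_inv (α := β.flip) (by rwa [Letter.tgt_flip])
  have hq' := hq.flip
  rw [Letter.flip_flip] at hq'
  obtain ⟨r, hr⟩ := B.exists_nonzero_arr (B.tgt_mem_of_nonzero hq')
  exact ⟨q, r, hr, hq'⟩

/-- A new arrow does not connect two old vertices. -/
theorem mem_range_arrow (B : Blossoming Q Q') {q : A'} (hs : Q'.src q ∈ Set.range B.vert)
    (ht : Q'.tgt q ∈ Set.range B.vert) : q ∈ Set.range B.arrow := by
  by_contra h
  rcases B.new_arrow q h with h | h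
  · exact h.2 ht
  · exact h.2 hs

end Blossoming

/-! ### Shifts, reversals and slices of words -/

theorem Walk.Same.str_eq {V : Type u₁} {A : Type u₂} {Q : GentleQuiver V A} {γ δ : Walk Q}
    (h : γ.Same δ) : γ.str = δ.str :=
  Quotient.sound (s := walkSetoid Q) (Or.inl h)

theorem Walk.Inv.str_eq {V : Type u₁} {A : Type u₂} {Q : GentleQuiver V A} {γ δ : Walk Q}
    (h : γ.Inv δ) : γ.str = δ.str :=
  Quotient.sound (s := walkSetoid Q) (Or.inr h)

namespace Word

variable {V : Type u₁} {A : Type u₂} {Q : GentleQuiver V A}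

theorem ext_letter {w v : Word Q} (h : ∀ i, w.letter i = v.letter i) : w = v := by
  cases w
  cases v
  congr
  exact funext h

theorem letter_ne_none (w : Word Q) {i j k : ℤ} (hi : w.letter i ≠ none) (hk : w.letter k ≠ none)
    (hij : i ≤ j) (hjk : j ≤ k) : w.letter j ≠ none :=
  w.interval.out hi hk ⟨hij, hjk⟩

theorem nonzero_of_pred (w : Word Q) {k : ℤ} {α β : Letter A} (hα : w.letter (k - 1) = some α)
    (hβ : w.letter k = some β) : α.Nonzero Q β :=
  w.nonzero (k - 1) α β hα (by rwa [sub_add_cancel])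

/-- The word `w` with its indices shifted by `n`. -/
def shift (w : Word Q) (n : ℤ) : Word Q where
  letter i := w.letter (i + n)
  nonempty := by
    obtain ⟨i, hi⟩ := w.nonempty
    exact ⟨i - n, by rwa [sub_add_cancel]⟩
  interval := ⟨fun i hi k hk j hj => w.letter_ne_none (i := i + n) (k := k + n) hi hk
    (by linarith [hj.1]) (by linarith [hj.2])⟩
  nonzero i α β hα hβ := w.nonzero (i + n) α β hα (by rwa [add_right_comm] at hβ)

/-- The inverse word. The indexing is such that the cut before the index `k` of `w` is the cut
before the index `-k` of `w.rev`. -/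
def rev (w : Word Q) : Word Q where
  letter i := (w.letter (-1 - i)).map Letter.flip
  nonempty := by
    obtain ⟨i, hi⟩ := w.nonempty
    exact ⟨-1 - i, by simpa using hi⟩
  interval := ⟨fun i hi k hk j hj => by
    simp only [ne_eq, Option.map_eq_none_iff, Set.mem_ofPred_eq] at hi hk ⊢
    exact w.letter_ne_none hk hi (by linarith [hj.2]) (by linarith [hj.1])⟩
  nonzero i α β hα hβ := by
    simp only [Option.map_eq_some_iff] at hα hβ
    obtain ⟨α', hα', rfl⟩ := hα
    obtain ⟨β', hβ', rfl⟩ := hβ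
    refine (w.nonzero (-1 - (i + 1)) β' α' hβ' ?_).flip
    rwa [show -1 - (i + 1) + 1 = -1 - i by ring]

theorem shift_letter (w : Word Q) (n i : ℤ) : (w.shift n).letter i = w.letter (i + n) := rfl

theorem rev_letter (w : Word Q) (i : ℤ) :
    w.rev.letter i = (w.letter (-1 - i)).map Letter.flip := rfl

theorem rev_letter_ne_none {w : Word Q} {i : ℤ} :
    w.rev.letter i ≠ none ↔ w.letter (-1 - i) ≠ none := by
  simp [rev_letter]

theorem rev_letter_eq_some {w : Word Q} {i : ℤ} {α : Letter A} :
    w.rev.letter i = some α ↔ w.letter (-1 - i) = some α.flip := by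
  rw [rev_letter, Option.map_eq_some_iff]
  constructor
  · rintro ⟨β, hβ, rfl⟩
    rw [hβ, Letter.flip_flip]
  · intro h
    exact ⟨_, h, Letter.flip_flip α⟩

theorem rev_rev (w : Word Q) : w.rev.rev = w := by
  refine ext_letter fun i => ?_
  ext α
  rw [rev_letter_eq_some, rev_letter_eq_some, Letter.flip_flip]
  ring_nf

theorem shift_shift_neg (w : Word Q) (n : ℤ) : (w.shift n).shift (-n) = w :=
  ext_letter fun i => by simp [shift_letter]

theorem str_shift (w : Word Q) (n : ℤ) : (Walk.word (w.shift n)).str = (Walk.word w).str :=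
  (Walk.Same.str_eq (γ := .word w) (δ := .word (w.shift n)) ⟨n, fun _ => rfl⟩).symm

theorem str_rev (w : Word Q) : (Walk.word w.rev).str = (Walk.word w).str :=
  (Walk.Inv.str_eq (γ := .word w) (δ := .word w.rev) ⟨-1, fun _ => rfl⟩).symm

theorem eq_shift_or_eq_rev_shift {w v : Word Q} (h : (Walk.word w).str = (Walk.word v).str) :
    ∃ n, v = w.shift n ∨ v = w.rev.shift n := by
  rcases Quotient.exact h with ⟨n, hn⟩ | ⟨n, hn⟩
  · exact ⟨n, Or.inl (ext_letter hn)⟩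
  · refine ⟨-1 - n, Or.inr (ext_letter fun i => ?_)⟩
    rw [hn, shift_letter, rev_letter]
    congr 2
    ring

/-- A property of words that is preserved by shifts and reversal is a property of strings. -/
theorem of_str_eq {P : Word Q → Prop} (hs : ∀ w n, P w → P (w.shift n)) (hr : ∀ w, P w → P w.rev)
    {w v : Word Q} (h : (Walk.word w).str = (Walk.word v).str) (hw : P w) : P v := by
  obtain ⟨n, rfl | rfl⟩ := eq_shift_or_eq_rev_shift h
  · exact hs _ _ hw
  · exact hs _ _ (hr _ hw)

/-- The part of the word `w` between the cuts `a` and `b`. -/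
def slice (w : Word Q) (a b : ℤ) (h : ∃ i, a ≤ i ∧ i < b ∧ w.letter i ≠ none) : Word Q where
  letter i := if a ≤ i ∧ i < b then w.letter i else none
  nonempty := by
    obtain ⟨i, h1, h2, h3⟩ := h
    exact ⟨i, by rwa [if_pos ⟨h1, h2⟩]⟩
  interval := ⟨fun i hi k hk j hj => by
    simp only [ne_eq, ite_eq_right_iff, Classical.not_imp, Set.mem_ofPred_eq] at hi hk ⊢
    exact ⟨⟨hi.1.1.trans hj.1, hj.2.trans_lt hk.1.2⟩, w.letter_ne_none hi.2 hk.2 hj.1 hj.2⟩⟩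
  nonzero i α β hα hβ := by
    split_ifs at hα hβ
    exact w.nonzero i α β hα hβ

theorem slice_letter_eq_some {w : Word Q} {a b : ℤ} {h} {i : ℤ} {α : Letter A} :
    (w.slice a b h).letter i = some α ↔ w.letter i = some α ∧ a ≤ i ∧ i < b := by
  simp only [slice]
  split_ifs with hi <;> simp [hi]

theorem slice_letter {w : Word Q} {a b : ℤ} {h} {i : ℤ} (h1 : a ≤ i) (h2 : i < b) :
    (w.slice a b h).letter i = w.letter i := by
  simp [slice, h1, h2]

theorem slice_letter_eq_none {w : Word Q} {a b : ℤ} {h} {i : ℤ} (hi : ¬ (a ≤ i ∧ i < b)) :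
    (w.slice a b h).letter i = none := by
  simp only [slice, if_neg hi]

end Word

/-! ### Segments between cuts at old vertices -/

namespace Blossoming

variable {V : Type u₁} {A : Type u₂} {V' : Type u₃} {A' : Type u₄}
  {Q : GentleQuiver V A} {Q' : GentleQuiver V' A'}

/-- The cut of `w` just before the index `k` lies at an old vertex. At least one of the two letters
adjacent to the cut has to exist; the cut may be an end of `w`. -/
def Cut (B : Blossoming Q Q') (w : Word Q') (k : ℤ) : Prop :=
  (w.letter (k - 1) ≠ none ∨ w.letter k ≠ none) ∧
    (∀ α, w.letter (k - 1) = some α → α.tgt Q' ∈ Set.range B.vert) ∧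
    ∀ β, w.letter k = some β → β.src Q' ∈ Set.range B.vert

/-- `B.Seg w a b x`: the cuts `a ≤ b` of `w` lie at old vertices, and `x` is the string of the
subwalk of `w` between them, a stationary one if `a = b`. -/
def Seg (B : Blossoming Q Q') (w : Word Q') (a b : ℤ) (x : Str Q') : Prop :=
  a ≤ b ∧ B.Cut w a ∧ B.Cut w b ∧ ∃ ω : Walk Q', ω.str = x ∧ w.OccursAt (some a) (some b) ω

theorem cut_of_left (B : Blossoming Q Q') {w : Word Q'} {k : ℤ} {α : Letter A'}
    (hα : w.letter (k - 1) = some α) (h : α.tgt Q' ∈ Set.range B.vert) : B.Cut w k := by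
  refine ⟨Or.inl (by simp [hα]), fun α' hα' => ?_, fun β hβ => ?_⟩
  · rw [hα] at hα'
    cases hα'
    exact h
  · exact B.src_mem_of_nonzero (w.nonzero_of_pred hα hβ)

theorem cut_of_right (B : Blossoming Q Q') {w : Word Q'} {k : ℤ} {β : Letter A'}
    (hβ : w.letter k = some β) (h : β.src Q' ∈ Set.range B.vert) : B.Cut w k := by
  refine ⟨Or.inr (by simp [hβ]), fun α hα => ?_, fun β' hβ' => ?_⟩
  · exact B.tgt_mem_of_nonzero (w.nonzero_of_pred hα hβ)
  · rw [hβ] at hβ'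
    cases hβ'
    exact h

theorem cut_of_ne_none (B : Blossoming Q Q') {w : Word Q'} {k : ℤ}
    (hl : w.letter (k - 1) ≠ none) (hr : w.letter k ≠ none) : B.Cut w k := by
  obtain ⟨α, hα⟩ := Option.ne_none_iff_exists'.1 hl
  obtain ⟨β, hβ⟩ := Option.ne_none_iff_exists'.1 hr
  exact B.cut_of_left hα (B.tgt_mem_of_nonzero (w.nonzero_of_pred hα hβ))

variable {B : Blossoming Q Q'}

/-- Whether a cut lies at an old vertex depends only on one adjacent letter. -/
theorem Cut.congr {w v : Word Q'} {k : ℤ} (hw : B.Cut w k)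
    (h : (v.letter (k - 1) = w.letter (k - 1) ∧ w.letter (k - 1) ≠ none) ∨
      (v.letter k = w.letter k ∧ w.letter k ≠ none)) : B.Cut v k := by
  rcases h with ⟨h, hn⟩ | ⟨h, hn⟩
  · obtain ⟨α, hα⟩ := Option.ne_none_iff_exists'.1 hn
    exact B.cut_of_left (h.trans hα) (hw.2.1 α hα)
  · obtain ⟨α, hα⟩ := Option.ne_none_iff_exists'.1 hn
    exact B.cut_of_right (h.trans hα) (hw.2.2 α hα)

theorem Cut.shift {w : Word Q'} {k : ℤ} (h : B.Cut w k) (n : ℤ) : B.Cut (w.shift n) (k - n) := by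
  simp only [Cut, Word.shift_letter] at h ⊢
  rwa [show k - n - 1 + n = k - 1 by ring, show k - n + n = k by ring]

theorem Cut.rev {w : Word Q'} {k : ℤ} (h : B.Cut w k) : B.Cut w.rev (-k) := by
  simp only [Cut, Word.rev_letter_ne_none, Word.rev_letter_eq_some] at h ⊢
  rw [show -1 - (-k - 1) = k by ring, show -1 - -k = k - 1 by ring]
  refine ⟨h.1.symm, fun α hα => ?_, fun β hβ => ?_⟩
  · simpa [Letter.src_flip] using h.2.2 _ hα
  · simpa [Letter.tgt_flip] using h.2.1 _ hβ

/-- A cut in the interior of a word lies at an old vertex. -/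
theorem Cut.mid {w : Word Q'} {a b k : ℤ} (ha : B.Cut w a) (hb : B.Cut w b) (h1 : a ≤ k)
    (h2 : k ≤ b) : B.Cut w k := by
  rcases h1.eq_or_lt with rfl | h1
  · exact ha
  rcases h2.eq_or_lt with rfl | h2
  · exact hb
  obtain ⟨i, hi, hi'⟩ : ∃ i, i ≤ k - 1 ∧ w.letter i ≠ none := by
    rcases ha.1 with h | h
    · exact ⟨_, by omega, h⟩
    · exact ⟨_, by omega, h⟩
  obtain ⟨j, hj, hj'⟩ : ∃ j, k ≤ j ∧ w.letter j ≠ none := by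
    rcases hb.1 with h | h
    · exact ⟨_, by omega, h⟩
    · exact ⟨_, by omega, h⟩
  exact B.cut_of_ne_none (w.letter_ne_none hi' hj' hi (by omega))
    (w.letter_ne_none hi' hj' (by omega) hj)

theorem Cut.letter_ne_none {w : Word Q'} {a b i : ℤ} (ha : B.Cut w a) (hb : B.Cut w b)
    (h1 : a ≤ i) (h2 : i < b) : w.letter i ≠ none := by
  obtain ⟨j, hj, hj'⟩ : ∃ j, j ≤ i ∧ w.letter j ≠ none := by
    rcases ha.1 with h | h
    · exact ⟨_, by omega, h⟩
    · exact ⟨_, h1, h⟩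
  obtain ⟨k, hk, hk'⟩ : ∃ j, i ≤ j ∧ w.letter j ≠ none := by
    rcases hb.1 with h | h
    · exact ⟨_, by omega, h⟩
    · exact ⟨_, by omega, h⟩
  exact w.letter_ne_none hj' hk' hj hk

/-- Between two different cuts the subwalk is a slice. -/
theorem seg_iff_slice {w : Word Q'} {a b : ℤ} {x : Str Q'} (h : a < b) (ha : B.Cut w a)
    (hb : B.Cut w b) :
    B.Seg w a b x ↔
      (Walk.word (w.slice a b ⟨a, le_rfl, h, ha.letter_ne_none hb le_rfl h⟩)).str = x := by
  constructor
  · rintro ⟨-, -, -, ω, rfl, hω⟩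
    cases ω with
    | stat q r hqr =>
      obtain ⟨k, h1, h2, -⟩ := hω
      cases h1
      cases h2
      exact absurd h (lt_irrefl _)
    | word v =>
      obtain ⟨m, hm⟩ := hω
      rw [← Word.str_shift v (-m)]
      congr 2
      refine Word.ext_letter fun i => ?_
      ext α
      rw [Word.slice_letter_eq_some, Word.shift_letter, hm]
      simp
  · rintro rfl
    refine ⟨h.le, ha, hb, _, rfl, 0, fun i α => ?_⟩
    rw [Word.slice_letter_eq_some]
    simp

/-- At a single cut the subwalk is a stationary walk. -/
theorem seg_self_iff {w : Word Q'} {a : ℤ} {x : Str Q'} (ha : B.Cut w a) :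
    B.Seg w a a x ↔ ∃ q r h, (Walk.stat q r h).str = x ∧
      (∀ α ∈ w.letter (a - 1), α.Nonzero Q' (Letter.arr r)) ∧
      (∀ β ∈ w.letter a, (Letter.arr q).Nonzero Q' β) := by
  constructor
  · rintro ⟨-, -, -, ω, rfl, hω⟩
    cases ω with
    | stat q r hqr =>
      obtain ⟨k, h1, h2, -, h3, h4⟩ := hω
      cases h1
      exact ⟨q, r, hqr, rfl, h3, h4⟩
    | word v =>
      obtain ⟨m, hm⟩ := hω
      obtain ⟨i, hi⟩ := v.nonempty
      obtain ⟨α, hα⟩ := Option.ne_none_iff_exists'.1 hi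
      obtain ⟨-, h1, h2⟩ := (hm i α).1 hα
      exact absurd (h2 a rfl) (h1 a rfl).not_gt
  · rintro ⟨q, r, hqr, rfl, h3, h4⟩
    exact ⟨le_rfl, ha, ha, _, rfl, a, rfl, rfl, ha.1, h3, h4⟩

theorem exists_seg {w : Word Q'} {a b : ℤ} (hab : a ≤ b) (ha : B.Cut w a) (hb : B.Cut w b) :
    ∃ x, B.Seg w a b x := by
  rcases hab.eq_or_lt with rfl | h
  · simp only [seg_self_iff ha]
    rcases ha.1 with hn | hn
    · obtain ⟨α, hα⟩ := Option.ne_none_iff_exists'.1 hn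
      obtain ⟨q, r, hqr, hr⟩ := B.exists_stat_right (ha.2.1 α hα)
      refine ⟨_, q, r, hqr, rfl, fun α' hα' => ?_, fun β hβ => ?_⟩
      · rw [hα] at hα'
        cases hα'
        exact hr
      · exact hr.of_left hqr (w.nonzero_of_pred hα hβ)
    · obtain ⟨β, hβ⟩ := Option.ne_none_iff_exists'.1 hn
      obtain ⟨q, r, hqr, hr⟩ := B.exists_stat_left (ha.2.2 β hβ)
      refine ⟨_, q, r, hqr, rfl, fun α hα => ?_, fun β' hβ' => ?_⟩
      · exact hr.of_right hqr (w.nonzero_of_pred hα hβ)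
      · rw [hβ] at hβ'
        cases hβ'
        exact hr
  · exact ⟨_, (seg_iff_slice h ha hb).2 rfl⟩

theorem Seg.unique {w : Word Q'} {a b : ℤ} {x y : Str Q'} (hx : B.Seg w a b x)
    (hy : B.Seg w a b y) : x = y := by
  rcases hx.1.eq_or_lt with rfl | h
  · obtain ⟨q, r, hqr, rfl, h1, h2⟩ := (seg_self_iff hx.2.1).1 hx
    obtain ⟨q', r', hqr', rfl, h1', h2'⟩ := (seg_self_iff hx.2.1).1 hy
    have key : q = q' ∧ r = r' := by
      rcases hx.2.1.1 with hn | hn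
      · obtain ⟨α, hα⟩ := Option.ne_none_iff_exists'.1 hn
        have hr := (h1 α hα).arr_unique (h1' α hα)
        subst hr
        exact ⟨Q'.nonrel_left r q q' hqr.1 hqr'.1 hqr.2 hqr'.2, rfl⟩
      · obtain ⟨β, hβ⟩ := Option.ne_none_iff_exists'.1 hn
        have hq := (h2 β hβ).flip.inv_unique (h2' β hβ).flip
        subst hq
        exact ⟨rfl, hqr.arr_unique hqr'⟩
    obtain ⟨rfl, rfl⟩ := key
    rfl
  · rw [← (seg_iff_slice h hx.2.1 hx.2.2.1).1 hx, ← (seg_iff_slice h hx.2.1 hx.2.2.1).1 hy]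

/-- A segment depends only on the letters between its cuts or, if it is stationary, on one letter
adjacent to its cut. -/
theorem Seg.congr {w v : Word Q'} {a b : ℤ} {x : Str Q'} (hw : B.Seg w a b x)
    (h : ∀ i, a ≤ i → i < b → v.letter i = w.letter i)
    (h' : a = b → (v.letter (a - 1) = w.letter (a - 1) ∧ w.letter (a - 1) ≠ none) ∨
      (v.letter a = w.letter a ∧ w.letter a ≠ none)) : B.Seg v a b x := by
  rcases hw.1.eq_or_lt with rfl | hab
  · have hc : B.Cut v a := hw.2.1.congr (h' rfl)
    obtain ⟨q, r, hqr, rfl, h1, h2⟩ := (seg_self_iff hw.2.1).1 hw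
    refine (seg_self_iff hc).2 ⟨q, r, hqr, rfl, ?_, ?_⟩ <;> rcases h' rfl with ⟨e, hn⟩ | ⟨e, hn⟩
    · rwa [e]
    · obtain ⟨β, hβ⟩ := Option.ne_none_iff_exists'.1 hn
      exact fun α hα => (h2 β hβ).of_right hqr (v.nonzero_of_pred hα (e.trans hβ))
    · obtain ⟨α, hα⟩ := Option.ne_none_iff_exists'.1 hn
      exact fun β hβ => (h1 α hα).of_left hqr (v.nonzero_of_pred (e.trans hα) hβ)
    · rwa [e]
  · have hne : ∀ i, a ≤ i → i < b → w.letter i ≠ none := fun i h1 h2 =>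
      hw.2.1.letter_ne_none hw.2.2.1 h1 h2
    have ha : B.Cut v a := hw.2.1.congr (Or.inr ⟨h a le_rfl hab, hne a le_rfl hab⟩)
    have hb : B.Cut v b := hw.2.2.1.congr
      (Or.inl ⟨h (b - 1) (by omega) (by omega), hne (b - 1) (by omega) (by omega)⟩)
    rw [seg_iff_slice hab ha hb]
    rw [seg_iff_slice hab hw.2.1 hw.2.2.1] at hw
    rw [← hw]
    congr 2
    refine Word.ext_letter fun i => ?_
    by_cases hi : a ≤ i ∧ i < b
    · rw [Word.slice_letter hi.1 hi.2, Word.slice_letter hi.1 hi.2, h i hi.1 hi.2]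
    · rw [Word.slice_letter_eq_none hi, Word.slice_letter_eq_none hi]

theorem _root_.Word.OccursAt.shift {w : Word Q'} {a b : ℤ} {ω : Walk Q'}
    (hω : w.OccursAt (some a) (some b) ω) (n : ℤ) :
    (w.shift n).OccursAt (some (a - n)) (some (b - n)) ω := by
  cases ω with
  | stat q r hqr =>
    obtain ⟨k, h1, h2, h3⟩ := hω
    cases h1
    cases h2
    refine ⟨a - n, rfl, rfl, ?_⟩
    simpa only [Word.shift_letter, show a - n - 1 + n = a - 1 by ring, sub_add_cancel] using h3
  | word v =>
    obtain ⟨m, hm⟩ := hω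
    refine ⟨m - n, fun i α => ?_⟩
    rw [hm, Word.shift_letter, show i + (m - n) + n = i + m by ring]
    simp only [Option.mem_def, Option.some.injEq, forall_eq']
    refine and_congr_right fun _ => ?_
    omega

theorem Seg.shift {w : Word Q'} {a b : ℤ} {x : Str Q'} (h : B.Seg w a b x) (n : ℤ) :
    B.Seg (w.shift n) (a - n) (b - n) x := by
  obtain ⟨hab, ha, hb, ω, hx, hω⟩ := h
  exact ⟨by omega, ha.shift n, hb.shift n, ω, hx, hω.shift n⟩

theorem occursAt_rev_stat {w : Word Q'} {k : ℤ} {q r q' r' : A'} {h h'} (hq : q ≠ q')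
    (ht : Q'.tgt q = Q'.tgt q') (hw : w.OccursAt (some k) (some k) (Walk.stat q r h)) :
    w.rev.OccursAt (some (-k)) (some (-k)) (Walk.stat q' r' h') := by
  obtain ⟨_, h1, -, h2, h3, h4⟩ := hw
  cases h1
  refine ⟨-k, rfl, rfl, ?_, fun α hα => ?_, fun β hβ => ?_⟩
  · rw [Word.rev_letter_ne_none, Word.rev_letter_ne_none, show -1 - (-k - 1) = k by ring,
      show -1 - -k = k - 1 by ring]
    exact h2.symm
  · rw [Option.mem_def, Word.rev_letter_eq_some, show -1 - (-k - 1) = k by ring] at hα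
    have := Letter.Nonzero.stat_inv_left hq ht h h' (h4 _ hα)
    rwa [Letter.flip_flip] at this
  · rw [Option.mem_def, Word.rev_letter_eq_some, show -1 - -k = k - 1 by ring] at hβ
    have := Letter.Nonzero.stat_inv_right hq ht h h' (h3 _ hβ)
    rwa [Letter.flip_flip] at this

theorem Seg.rev {w : Word Q'} {a b : ℤ} {x : Str Q'} (h : B.Seg w a b x) :
    B.Seg w.rev (-b) (-a) x := by
  obtain ⟨hab, ha, hb, ω, hx, hω⟩ := h
  refine ⟨by omega, hb.rev, ha.rev, ?_⟩
  cases ω with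
  | stat q r hqr =>
    obtain ⟨k, h1, h2, -⟩ := id hω
    cases h1
    cases h2
    obtain ⟨i, hi⟩ := B.tgt_mem_of_nonzero hqr
    obtain ⟨q', hq', hne⟩ := exists_ne_of_encard_eq_two (B.old_in i) q
    have ht : Q'.tgt q = Q'.tgt q' := hi.symm.trans hq'.symm
    obtain ⟨r', hr'⟩ := B.exists_nonzero_arr (α := Letter.arr q') ⟨i, hq'.symm⟩
    refine ⟨Walk.stat q' r' hr', ?_, occursAt_rev_stat hne ht hω⟩
    rw [← hx]
    exact (Walk.Inv.str_eq (γ := .stat q r hqr) (δ := .stat q' r' hr') ⟨hne, ht⟩).symm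
  | word v =>
    obtain ⟨m, hm⟩ := hω
    refine ⟨Walk.word v.rev, (Word.str_rev v).trans hx, -m, fun i α => ?_⟩
    rw [Word.rev_letter_eq_some, hm, Word.rev_letter_eq_some,
      show -1 - (i + -m) = -1 - i + m by ring]
    simp only [Option.mem_def, Option.some.injEq, forall_eq']
    refine and_congr_right fun _ => ?_
    omega

end Blossoming

/-! ### Confined and infinite words -/

namespace Word

variable {V : Type u₁} {A : Type u₂} {Q : GentleQuiver V A}

theorem str_stat_ne_str_word {q r : A} {h} {w : Word Q} :
    (Walk.stat q r h).str ≠ (Walk.word w).str := by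
  intro e
  rcases Quotient.exact e with h | h <;> exact h

theorem exists_first {w : Word Q} (h : BddBelow {i | w.letter i ≠ none}) :
    ∃ i, w.letter i ≠ none ∧ w.letter (i - 1) = none := by
  obtain ⟨b, hb⟩ := h
  obtain ⟨i, hi, hi'⟩ := Int.exists_least_of_bdd (P := fun i => w.letter i ≠ none)
    ⟨b, fun z hz => hb hz⟩ w.nonempty
  refine ⟨i, hi, by_contra fun hn => ?_⟩
  have := hi' _ hn
  omega

theorem exists_last {w : Word Q} (h : BddAbove {i | w.letter i ≠ none}) :
    ∃ i, w.letter i ≠ none ∧ w.letter (i + 1) = none := by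
  obtain ⟨b, hb⟩ := h
  obtain ⟨i, hi, hi'⟩ := Int.exists_greatest_of_bdd (P := fun i => w.letter i ≠ none)
    ⟨b, fun z hz => hb hz⟩ w.nonempty
  refine ⟨i, hi, by_contra fun hn => ?_⟩
  have := hi' _ hn
  omega

theorem le_of_letter_eq_none {w : Word Q} {i j : ℤ} (hi : w.letter i ≠ none)
    (hi' : w.letter (i - 1) = none) (hj : w.letter j ≠ none) : i ≤ j := by
  by_contra h
  exact w.letter_ne_none hj hi (by omega : j ≤ i - 1) (by omega) hi'

theorem lt_of_letter_eq_none {w : Word Q} {i j : ℤ} (hi : w.letter (i - 1) ≠ none)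
    (hi' : w.letter i = none) (hj : w.letter j ≠ none) : j < i := by
  by_contra h
  exact w.letter_ne_none hi hj (by omega : i - 1 ≤ i) (by omega) hi'

end Word

namespace Blossoming

variable {V : Type u₁} {A : Type u₂} {V' : Type u₃} {A' : Type u₄}
  {Q : GentleQuiver V A} {Q' : GentleQuiver V' A'} {B : Blossoming Q Q'}

theorem Seg.confined {w : Word Q'} {a b : ℤ} {x : Str Q'} (h : B.Seg w a b x) :
    B.IsConfined x := by
  rcases h.1.eq_or_lt with rfl | hab
  · obtain ⟨q, r, hqr, rfl, -⟩ := (seg_self_iff h.2.1).1 h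
    exact ⟨_, rfl, id, id⟩
  · refine ⟨_, (seg_iff_slice hab h.2.1 h.2.2.1).1 h, ?_, ?_⟩
    · rintro (hb | ⟨i, α, h1, h2, h3⟩)
      · refine hb ⟨a, fun i hi => ?_⟩
        by_contra hn
        exact hi (Word.slice_letter_eq_none fun h => hn h.1)
      · rw [Word.slice_letter_eq_some] at h1
        rcases h1.2.1.eq_or_lt with rfl | hlt
        · exact h3 (h.2.1.2.2 α h1.1)
        · rw [Word.slice_letter (by omega) (by omega)] at h2
          exact h.2.1.letter_ne_none h.2.2.1 (by omega) (by omega) h2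
    · rintro (hb | ⟨i, α, h1, h2, h3⟩)
      · refine hb ⟨b, fun i hi => ?_⟩
        by_contra hn
        exact hi (Word.slice_letter_eq_none fun h => hn h.2.le)
      · rw [Word.slice_letter_eq_some] at h1
        rcases (show i + 1 ≤ b by omega).eq_or_lt with e | hlt
        · refine h3 (h.2.2.1.2.1 α ?_)
          rw [← e, add_sub_cancel_right]
          exact h1.1
        · rw [Word.slice_letter (by omega) (by omega)] at h2
          exact h.2.1.letter_ne_none h.2.2.1 (by omega) (by omega) h2

/-- A word that starts and ends at old vertices is a segment of itself. -/
theorem seg_of_eq_none {w : Word Q'} {a b : ℤ} (hab : a < b) (ha : B.Cut w a) (hb : B.Cut w b)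
    (ha' : w.letter (a - 1) = none) (hb' : w.letter b = none) : B.Seg w a b (Walk.word w).str := by
  rw [seg_iff_slice hab ha hb]
  congr 2
  refine Word.ext_letter fun i => ?_
  by_cases hi : a ≤ i ∧ i < b
  · exact Word.slice_letter hi.1 hi.2
  · rw [Word.slice_letter_eq_none hi]
    by_contra hn
    refine hi ⟨?_, ?_⟩
    · exact Word.le_of_letter_eq_none (ha.letter_ne_none hb le_rfl hab) ha' (Ne.symm hn)
    · exact Word.lt_of_letter_eq_none (ha.letter_ne_none hb (by omega) (by omega)) hb' (Ne.symm hn)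

theorem exists_cuts_of_isConfined {w : Word Q'} (h : B.IsConfined (Walk.word w).str) :
    ∃ a b, a < b ∧ B.Cut w a ∧ B.Cut w b ∧ w.letter (a - 1) = none ∧ w.letter b = none := by
  obtain ⟨γ, hγ, hl, hr⟩ := h
  cases γ with
  | stat q r hqr => exact absurd hγ Word.str_stat_ne_str_word
  | word v =>
    refine Word.of_str_eq (P := fun w => ∃ a b, a < b ∧ B.Cut w a ∧ B.Cut w b ∧
      w.letter (a - 1) = none ∧ w.letter b = none) ?_ ?_ hγ ?_
    · rintro u n ⟨a, b, hab, ha, hb, ha', hb'⟩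
      refine ⟨a - n, b - n, by omega, ha.shift n, hb.shift n, ?_, ?_⟩
      · rwa [Word.shift_letter, show a - n - 1 + n = a - 1 by ring]
      · rwa [Word.shift_letter, sub_add_cancel]
    · rintro u ⟨a, b, hab, ha, hb, ha', hb'⟩
      refine ⟨-b, -a, by omega, hb.rev, ha.rev, ?_, ?_⟩
      · rw [Word.rev_letter, show -1 - (-b - 1) = b by ring, hb', Option.map_none]
      · rw [Word.rev_letter, show -1 - -a = a - 1 by ring, ha', Option.map_none]
    · simp only [LeftInfinite, RightInfinite, not_or, not_not, not_exists, not_and] at hl hr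
      obtain ⟨i, hi, hi'⟩ := Word.exists_first hl.1
      obtain ⟨j, hj, hj'⟩ := Word.exists_last hr.1
      obtain ⟨α, hα⟩ := Option.ne_none_iff_exists'.1 hi
      obtain ⟨β, hβ⟩ := Option.ne_none_iff_exists'.1 hj
      refine ⟨i, j + 1, ?_, B.cut_of_right hα (hl.2 i α hα hi'),
        B.cut_of_left (by rwa [add_sub_cancel_right]) (hr.2 j β hβ hj'), hi', hj'⟩
      have := Word.le_of_letter_eq_none hi hi' hj
      omega

theorem isConfined_of_cuts {w : Word Q'} {a b : ℤ} (hab : a < b) (ha : B.Cut w a) (hb : B.Cut w b)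
    (ha' : w.letter (a - 1) = none) (hb' : w.letter b = none) : B.IsConfined (Walk.word w).str :=
  (seg_of_eq_none hab ha hb ha' hb').confined

/-- At each cut of `w` at an old vertex both adjacent letters exist, so that `w` does not end at an
old vertex. This means that its string is infinite (`isInfinite_iff`). -/
def InfWord (B : Blossoming Q Q') (w : Word Q') : Prop :=
  ∀ k, B.Cut w k → w.letter (k - 1) ≠ none ∧ w.letter k ≠ none

theorem InfWord.shift {w : Word Q'} (h : B.InfWord w) (n : ℤ) : B.InfWord (w.shift n) := by
  intro k hk
  have h1 := hk.shift (-n)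
  rw [Word.shift_shift_neg] at h1
  have := h _ h1
  simp only [Word.shift_letter]
  rwa [show k - 1 + n = k - -n - 1 by ring, show k + n = k - -n by ring]

theorem InfWord.rev {w : Word Q'} (h : B.InfWord w) : B.InfWord w.rev := by
  intro k hk
  have h1 := hk.rev
  rw [Word.rev_rev] at h1
  have := h _ h1
  rw [Word.rev_letter_ne_none, Word.rev_letter_ne_none, show -1 - (k - 1) = -k by ring,
    show -1 - k = -k - 1 by ring]
  exact this.symm

theorem isInfinite_iff {w : Word Q'} : B.IsInfinite (Walk.word w).str ↔ B.InfWord w := by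
  constructor
  · rintro ⟨γ, hγ, hl, hr⟩
    cases γ with
    | stat q r hqr => exact hl.elim
    | word v =>
      refine Word.of_str_eq (fun u n hu => hu.shift n) (fun u hu => hu.rev) hγ fun k hk => ⟨?_, ?_⟩
      · intro hn
        have hk' := hk.1.resolve_left (not_not.2 hn)
        rcases hl with hl | ⟨i, α, h1, h2, h3⟩
        · exact hl ⟨k, fun j hj => Word.le_of_letter_eq_none hk' hn hj⟩
        · have hi : v.letter i ≠ none := by simp [h1]
          obtain rfl : i = k := le_antisymm (Word.le_of_letter_eq_none hi h2 hk')
            (Word.le_of_letter_eq_none hk' hn hi)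
          exact h3 (hk.2.2 α h1)
      · intro hn
        have hk' := hk.1.resolve_right (not_not.2 hn)
        rcases hr with hr | ⟨i, α, h1, h2, h3⟩
        · exact hr ⟨k, fun j hj => (Word.lt_of_letter_eq_none hk' hn hj).le⟩
        · have hi : v.letter i ≠ none := by simp [h1]
          have h4 := Word.lt_of_letter_eq_none hk' hn hi
          have h5 := Word.lt_of_letter_eq_none (i := i + 1) (by rwa [add_sub_cancel_right]) h2 hk'
          obtain rfl : i = k - 1 := by omega
          exact h3 (hk.2.1 α h1)
  · intro h
    refine ⟨_, rfl, ?_, ?_⟩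
    · by_contra hl
      simp only [LeftInfinite, not_or, not_not, not_exists, not_and] at hl
      obtain ⟨i, hi, hi'⟩ := Word.exists_first hl.1
      obtain ⟨α, hα⟩ := Option.ne_none_iff_exists'.1 hi
      exact (h i (B.cut_of_right hα (hl.2 i α hα hi'))).1 hi'
    · by_contra hr
      simp only [RightInfinite, not_or, not_not, not_exists, not_and] at hr
      obtain ⟨i, hi, hi'⟩ := Word.exists_last hr.1
      obtain ⟨α, hα⟩ := Option.ne_none_iff_exists'.1 hi
      exact (h (i + 1) (B.cut_of_left (by rwa [add_sub_cancel_right]) (hr.2 i α hα hi'))).2 hi'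

theorem exists_infWord {x : Str Q'} (h : B.IsInfinite x) :
    ∃ w : Word Q', (Walk.word w).str = x ∧ B.InfWord w := by
  obtain ⟨γ, rfl, hl, hr⟩ := id h
  cases γ with
  | stat q r hqr => exact hl.elim
  | word w => exact ⟨w, rfl, isInfinite_iff.1 h⟩

end Blossoming

/-! ### Factors as segments -/

namespace Word

variable {V : Type u₁} {A : Type u₂} {Q : GentleQuiver V A}

/-- The letter before the cut `a`, if there is one, is an inverse arrow. -/
def FactorLeft (w : Word Q) (a : ℤ) : Prop := ∀ α, w.letter (a - 1) = some α → α.IsInverse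

/-- The letter after the cut `b`, if there is one, is an arrow. -/
def FactorRight (w : Word Q) (b : ℤ) : Prop := ∀ β, w.letter b = some β → β.IsArrow

/-- The letters of `v` are the letters of `w` between the cuts `a` and `b`; here `none` means that
there is no bound. -/
def IsPart (v w : Word Q) (a b : Option ℤ) : Prop :=
  ∀ i α, v.letter i = some α ↔ w.letter i = some α ∧ (∀ k ∈ a, k ≤ i) ∧ ∀ k ∈ b, i < k

theorem exists_isPart {v w : Word Q} {a b : Option ℤ} (h : w.OccursAt a b (Walk.word v)) :
    ∃ v', (Walk.word v').str = (Walk.word v).str ∧ v'.IsPart w a b := by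
  obtain ⟨m, hm⟩ := h
  refine ⟨v.shift (-m), v.str_shift _, fun i α => ?_⟩
  rw [shift_letter, hm]
  simp

theorem FactorRight.rev {w : Word Q} {b : ℤ} (h : w.FactorRight b) : w.rev.FactorLeft (-b) := by
  intro α hα
  rw [rev_letter_eq_some, show -1 - (-b - 1) = b by ring] at hα
  exact Letter.isArrow_flip.1 (h _ hα)

theorem FactorLeft.rev {w : Word Q} {a : ℤ} (h : w.FactorLeft a) : w.rev.FactorRight (-a) := by
  intro α hα
  rw [rev_letter_eq_some, show -1 - -a = a - 1 by ring] at hα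
  exact Letter.isInverse_flip.1 (h _ hα)

theorem IsPart.letter_eq {v w : Word Q} {a b : Option ℤ} (h : v.IsPart w a b) {i : ℤ}
    (hi : v.letter i ≠ none) : w.letter i = v.letter i := by
  obtain ⟨α, hα⟩ := Option.ne_none_iff_exists'.1 hi
  rw [hα]
  exact ((h i α).1 hα).1

/-- A property of letters that holds for the letter before a part, and for the letter before a cut
in the part, holds for the letter before this cut in the whole word. -/
theorem IsPart.before {v w : Word Q} {a b : Option ℤ} (h : v.IsPart w a b) {P : Letter A → Prop}
    (ha : ∀ α ∈ w.before a, P α) {c : ℤ} (hc : v.letter (c - 1) ≠ none ∨ v.letter c ≠ none)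
    (hP : ∀ α, v.letter (c - 1) = some α → P α) {α : Letter A} (hα : w.letter (c - 1) = some α) :
    P α := by
  by_cases hv : v.letter (c - 1) = none
  · obtain ⟨β, hβ⟩ := Option.ne_none_iff_exists'.1 (hc.resolve_left (not_not.2 hv))
    obtain ⟨-, h1, h2⟩ := (h _ _).1 hβ
    cases a with
    | none =>
      refine hP α ((h _ _).2 ⟨hα, by simp, fun k hk => ?_⟩)
      have := h2 k hk
      omega
    | some k =>
      have hk := h1 k rfl
      rcases hk.eq_or_lt with rfl | hlt
      · exact ha α hα
      · refine hP α ((h _ _).2 ⟨hα, ?_, fun k hk => ?_⟩)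
        · rintro _ ⟨⟩
          omega
        · have := h2 k hk
          omega
  · exact hP α ((h.letter_eq hv).symm.trans hα)

theorem IsPart.after {v w : Word Q} {a b : Option ℤ} (h : v.IsPart w a b) {P : Letter A → Prop}
    (hb : ∀ β ∈ w.after b, P β) {d : ℤ} (hd : v.letter (d - 1) ≠ none ∨ v.letter d ≠ none)
    (hP : ∀ β, v.letter d = some β → P β) {β : Letter A} (hβ : w.letter d = some β) :
    P β := by
  by_cases hv : v.letter d = none
  · obtain ⟨α, hα⟩ := Option.ne_none_iff_exists'.1 (hd.resolve_right (not_not.2 hv))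
    obtain ⟨-, h1, h2⟩ := (h _ _).1 hα
    cases b with
    | none =>
      refine hP β ((h _ _).2 ⟨hβ, fun k hk => ?_, by simp⟩)
      have := h1 k hk
      omega
    | some k =>
      have hk := h2 k rfl
      rcases (show d ≤ k by omega).eq_or_lt with rfl | hlt
      · exact hb β hβ
      · refine hP β ((h _ _).2 ⟨hβ, fun k hk => ?_, ?_⟩)
        · have := h1 k hk
          omega
        · rintro _ ⟨⟩
          exact hlt
  · exact hP β ((h.letter_eq hv).symm.trans hβ)

end Word

namespace Blossoming

variable {V : Type u₁} {A : Type u₂} {V' : Type u₃} {A' : Type u₄}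
  {Q : GentleQuiver V A} {Q' : GentleQuiver V' A'} {B : Blossoming Q Q'}

theorem Cut.of_isPart {v w : Word Q'} {a b : Option ℤ} (h : v.IsPart w a b) {c : ℤ}
    (hc : B.Cut v c) : B.Cut w c := by
  refine hc.congr (hc.1.imp ?_ ?_) <;> exact fun hn => ⟨h.letter_eq hn, hn⟩

theorem Seg.of_isPart {v w : Word Q'} {a b : Option ℤ} (h : v.IsPart w a b) {c d : ℤ} {x : Str Q'}
    (hs : B.Seg v c d x) : B.Seg w c d x := by
  refine hs.congr (fun i h1 h2 => h.letter_eq (hs.2.1.letter_ne_none hs.2.2.1 h1 h2)) fun _ => ?_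
  refine hs.2.1.1.imp ?_ ?_ <;> exact fun hn => ⟨h.letter_eq hn, hn⟩

/-- A segment of `w` inside a subwalk `γ` is a factor of `γ` if its ends are ends of `γ` or look
like the ends of a factor of `w`. -/
theorem Seg.isFactor {w : Word Q'} {a b : Option ℤ} {γ : Walk Q'} {c d : ℤ} {x : Str Q'}
    (hs : B.Seg w c d x) (h : w.OccursAt a b γ) (ha : ∀ k ∈ a, k ≤ c) (hb : ∀ k ∈ b, d ≤ k)
    (hc : a = some c ∨ w.FactorLeft c) (hd : b = some d ∨ w.FactorRight d) :
    x.IsFactor γ.str := by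
  cases γ with
  | stat q r hqr =>
    obtain ⟨k, rfl, rfl, -⟩ := id h
    have h1 := ha k rfl
    have h2 := hb k rfl
    obtain rfl : c = k := le_antisymm (hs.1.trans h2) h1
    obtain rfl : d = c := le_antisymm h2 hs.1
    exact Or.inl (Seg.unique (B := B) ⟨le_rfl, hs.2.1, hs.2.1, _, rfl, h⟩ hs)
  | word v =>
    obtain ⟨v', hv', hp⟩ := Word.exists_isPart h
    have hlt : ∀ i, c ≤ i → i < d → v'.letter i = w.letter i := by
      intro i h1 h2
      obtain ⟨α, hα⟩ := Option.ne_none_iff_exists'.1 (hs.2.1.letter_ne_none hs.2.2.1 h1 h2)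
      rw [hα]
      exact (hp _ _).2 ⟨hα, fun k hk => (ha k hk).trans h1, fun k hk => h2.trans_le (hb k hk)⟩
    have hseg : B.Seg v' c d x := by
      refine hs.congr hlt ?_
      rintro rfl
      obtain ⟨j, hj⟩ := v'.nonempty
      obtain ⟨β, hβ⟩ := Option.ne_none_iff_exists'.1 hj
      obtain ⟨h1, h2, h3⟩ := (hp _ _).1 hβ
      have hj : w.letter j ≠ none := by simp [h1]
      -- the part has a letter on one side of the cut, and hence one adjacent to the cut
      rcases lt_or_ge j c with hjc | hjc
      · left
        have hn : w.letter (c - 1) ≠ none := by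
          rcases hs.2.1.1 with hn | hn
          · exact hn
          · exact w.letter_ne_none hj hn (by omega) (by omega)
        obtain ⟨α, hα⟩ := Option.ne_none_iff_exists'.1 hn
        refine ⟨?_, hn⟩
        rw [hα]
        refine (hp _ _).2 ⟨hα, fun k hk => ?_, fun k hk => ?_⟩
        · have := h2 k hk
          omega
        · have := hb k hk
          omega
      · right
        have hn : w.letter c ≠ none := by
          rcases hs.2.1.1 with hn | hn
          · exact w.letter_ne_none hn hj (by omega) (by omega)
          · exact hn
        obtain ⟨α, hα⟩ := Option.ne_none_iff_exists'.1 hn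
        refine ⟨?_, hn⟩
        rw [hα]
        refine (hp _ _).2 ⟨hα, ha, fun k hk => ?_⟩
        have := h3 k hk
        omega
    obtain ⟨hcd, -, -, ω, hω, ho⟩ := hseg
    refine Or.inr ⟨v', ω, some c, some d, hv', hω, ho, fun α hα => ?_, fun β hβ => ?_⟩
    · obtain ⟨h1, h2, -⟩ := (hp _ _).1 (show v'.letter (c - 1) = some α from hα)
      refine (hc.resolve_left ?_) α h1
      rintro rfl
      have := h2 c rfl
      omega
    · obtain ⟨h1, -, h2⟩ := (hp _ _).1 (show v'.letter d = some β from hβ)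
      refine (hd.resolve_left ?_) β h1
      rintro rfl
      exact (h2 d rfl).false

theorem Seg.isFactor_str {w : Word Q'} {c d : ℤ} {x : Str Q'} (hs : B.Seg w c d x)
    (hc : w.FactorLeft c) (hd : w.FactorRight d) : x.IsFactor (Walk.word w).str :=
  hs.isFactor (a := none) (b := none) ⟨0, by simp⟩ (by simp) (by simp) (Or.inr hc) (Or.inr hd)

/-- A segment of `w` inside a factor, with the ends of a factor there, has the ends of a factor
of `w`. -/
theorem exists_seg_of_isPart {v w : Word Q'} {a b : Option ℤ} (h : v.IsPart w a b)
    (ha : ∀ α ∈ w.before a, α.IsInverse) (hb : ∀ β ∈ w.after b, β.IsArrow) {c d : ℤ} {x : Str Q'}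
    (hs : B.Seg v c d x) (hc : v.FactorLeft c) (hd : v.FactorRight d) :
    B.Seg w c d x ∧ w.FactorLeft c ∧ w.FactorRight d :=
  ⟨hs.of_isPart h, fun _ => h.before ha hs.2.1.1 hc, fun _ => h.after hb hs.2.2.1.1 hd⟩

/-- The confined factors of a word are segments. -/
theorem exists_seg_of_isFactor {w : Word Q'} {y : Str Q'} (hy : B.IsConfined y)
    (h : y.IsFactor (Walk.word w).str) :
    ∃ c d, B.Seg w c d y ∧ w.FactorLeft c ∧ w.FactorRight d := by
  rcases h with rfl | ⟨v, ω, a, b, hv, rfl, ho, ha, hb⟩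
  · obtain ⟨a, b, hab, ha, hb, ha', hb'⟩ := exists_cuts_of_isConfined hy
    exact ⟨a, b, seg_of_eq_none hab ha hb ha' hb', fun α hα => by simp [ha'] at hα,
      fun α hα => by simp [hb'] at hα⟩
  · refine Word.of_str_eq (P := fun w => ∃ c d, B.Seg w c d ω.str ∧ w.FactorLeft c ∧
      w.FactorRight d) ?_ ?_ hv ?_
    · rintro u n ⟨c, d, h1, h2, h3⟩
      refine ⟨c - n, d - n, h1.shift n, fun α hα => h2 α ?_, fun β hβ => h3 β ?_⟩
      · rwa [Word.shift_letter, show c - n - 1 + n = c - 1 by ring] at hα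
      · rwa [Word.shift_letter, sub_add_cancel] at hβ
    · rintro u ⟨c, d, h1, h2, h3⟩
      exact ⟨-d, -c, h1.rev, h3.rev, h2.rev⟩
    · cases ω with
      | stat q r hqr =>
        obtain ⟨k, rfl, rfl, h1, h2, h3⟩ := id ho
        have hk : B.Cut v k := ⟨h1, fun α hα => B.tgt_mem_of_nonzero (h2 α hα),
          fun β hβ => B.src_mem_of_nonzero (h3 β hβ)⟩
        exact ⟨k, k, ⟨le_rfl, hk, hk, _, rfl, ho⟩, ha, hb⟩
      | word u =>
        obtain ⟨u', hu', hp⟩ := Word.exists_isPart ho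
        rw [← hu'] at hy ⊢
        obtain ⟨c, d, hcd, hc, hd, hc', hd'⟩ := exists_cuts_of_isConfined hy
        exact ⟨c, d, exists_seg_of_isPart hp ha hb (seg_of_eq_none hcd hc hd hc' hd')
          (fun α hα => by simp [hc'] at hα) (fun α hα => by simp [hd'] at hα)⟩

theorem eq_of_isFactor_stat {q r : A'} {h} {y : Str Q'}
    (hy : y.IsFactor (Walk.stat q r h : Walk Q').str) : y = (Walk.stat q r h).str := by
  rcases hy with h | ⟨w, _, _, _, h, -⟩
  · exact h.symm
  · exact absurd h.symm Word.str_stat_ne_str_word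

/-- A confined factor of a factor is a factor. -/
theorem isFactor_trans {x y z : Str Q'} (hz : B.IsConfined z) (hzy : z.IsFactor y)
    (hyx : y.IsFactor x) : z.IsFactor x := by
  rcases id hyx with rfl | ⟨w, ω, a, b, rfl, rfl, ho, ha, hb⟩
  · exact hzy
  cases ω with
  | stat q r hqr => rwa [eq_of_isFactor_stat hzy]
  | word v =>
    obtain ⟨v', hv', hp⟩ := Word.exists_isPart ho
    rw [← hv'] at hzy
    obtain ⟨c, d, h1, h2, h3⟩ := exists_seg_of_isFactor hz hzy
    obtain ⟨h1, h2, h3⟩ := exists_seg_of_isPart hp ha hb h1 h2 h3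
    exact h1.isFactor_str h2 h3

/-- Factors of confined strings are confined. -/
theorem isConfined_of_isFactor {x y : Str Q'} (hx : B.IsConfined x) (h : y.IsFactor x) :
    B.IsConfined y := by
  rcases h with rfl | ⟨w, ω, a, b, rfl, rfl, ho, -⟩
  · exact hx
  obtain ⟨s, e, hse, hs, he, hs', he'⟩ := exists_cuts_of_isConfined hx
  cases ω with
  | stat q r hqr => exact ⟨_, rfl, id, id⟩
  | word v =>
    obtain ⟨v', hv', hp⟩ := Word.exists_isPart ho
    rw [← hv']
    have hmem : ∀ i, v'.letter i ≠ none → s ≤ i ∧ i < e := fun i hi =>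
      ⟨Word.le_of_letter_eq_none (hs.letter_ne_none he le_rfl hse) hs' (hp.letter_eq hi ▸ hi),
        Word.lt_of_letter_eq_none (hs.letter_ne_none he (by omega) (by omega)) he'
          (hp.letter_eq hi ▸ hi)⟩
    obtain ⟨i, hi, hi'⟩ := Word.exists_first (w := v') ⟨s, fun i hi => (hmem i hi).1⟩
    obtain ⟨j, hj, hj'⟩ := Word.exists_last (w := v') ⟨e, fun i hi => (hmem i hi).2.le⟩
    have hij := Word.le_of_letter_eq_none hi hi' hj
    have h1 := hmem i hi
    have h2 := hmem j hj
    refine isConfined_of_cuts (a := i) (b := j + 1) (by omega) ?_ ?_ hi' hj'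
    · exact (hs.mid he (k := i) (by omega) (by omega)).congr
        (Or.inr ⟨(hp.letter_eq hi).symm, hp.letter_eq hi ▸ hi⟩)
    · refine (hs.mid he (k := j + 1) (by omega) (by omega)).congr (Or.inl ?_)
      rw [add_sub_cancel_right]
      exact ⟨(hp.letter_eq hj).symm, hp.letter_eq hj ▸ hj⟩

/-- Extensions of confined strings are confined. -/
theorem isConfined_of_isExtension {x y z : Str Q'} (hx : B.IsConfined x) (hy : B.IsConfined y)
    (h : B.IsExtension x y z) : B.IsConfined z := by
  obtain ⟨w, k, q, γ, δ, a, b, rfl, rfl, rfl, hk, hγ, ha, hδ, hb⟩ := h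
  obtain ⟨c, hck, hc, hc'⟩ : ∃ c, c ≤ k ∧ B.Cut w c ∧ w.letter (c - 1) = none := by
    cases γ with
    | stat q r hqr =>
      obtain ⟨l, rfl, e, -, -, h3⟩ := hγ
      cases e
      exact ⟨k, le_rfl, B.cut_of_right hk (B.src_mem_of_nonzero (h3 _ hk)), ha⟩
    | word v =>
      obtain ⟨v', hv', hp⟩ := Word.exists_isPart hγ
      rw [← hv'] at hx
      obtain ⟨c, d, hcd, hc, hd, hc', -⟩ := exists_cuts_of_isConfined hx
      obtain ⟨α, hα⟩ := Option.ne_none_iff_exists'.1 (hc.letter_ne_none hd le_rfl hcd)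
      refine ⟨c, (((hp _ _).1 hα).2.2 k rfl).le, hc.of_isPart hp,
        Option.eq_none_iff_forall_ne_some.2 fun α hα => ?_⟩
      exact hp.before (P := fun _ => False) (by simp [ha]) hc.1 (by simp [hc']) hα
  obtain ⟨d, hkd, hd, hd'⟩ : ∃ d, k < d ∧ B.Cut w d ∧ w.letter d = none := by
    cases δ with
    | stat q r hqr =>
      obtain ⟨l, e, rfl, -, h3, -⟩ := hδ
      cases e
      have hk' : w.letter (k + 1 - 1) = some _ := (add_sub_cancel_right k 1).symm ▸ hk
      exact ⟨k + 1, by omega, B.cut_of_left hk' (B.tgt_mem_of_nonzero (h3 _ hk')), hb⟩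
    | word v =>
      obtain ⟨v', hv', hp⟩ := Word.exists_isPart hδ
      rw [← hv'] at hy
      obtain ⟨c, d, hcd, hc, hd, -, hd'⟩ := exists_cuts_of_isConfined hy
      obtain ⟨α, hα⟩ := Option.ne_none_iff_exists'.1
        (hc.letter_ne_none hd (i := d - 1) (by omega) (by omega))
      have := ((hp _ _).1 hα).2.1 (k + 1) rfl
      refine ⟨d, by omega, hd.of_isPart hp, Option.eq_none_iff_forall_ne_some.2 fun α hα => ?_⟩
      exact hp.after (P := fun _ => False) (by simp [hb]) hd.1 (by simp [hd']) hα
  exact isConfined_of_cuts (by omega) hc hd hc' hd'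

end Blossoming

/-! ### Torsion sets -/

namespace Word

variable {V : Type u₁} {A : Type u₂} {Q : GentleQuiver V A}

/-- The letter with index `i` exists and is an arrow. -/
def ArrAt (w : Word Q) (i : ℤ) : Prop := ∃ q, w.letter i = some (Letter.arr q)

/-- The letter with index `i` exists and is an inverse arrow. -/
def InvAt (w : Word Q) (i : ℤ) : Prop := ∃ q, w.letter i = some (Letter.inv q)

theorem ArrAt.ne_none {w : Word Q} {i : ℤ} (h : w.ArrAt i) : w.letter i ≠ none := by
  obtain ⟨q, hq⟩ := h
  simp [hq]

theorem InvAt.ne_none {w : Word Q} {i : ℤ} (h : w.InvAt i) : w.letter i ≠ none := by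
  obtain ⟨q, hq⟩ := h
  simp [hq]

theorem ArrAt.not_invAt {w : Word Q} {i : ℤ} (h : w.ArrAt i) : ¬ w.InvAt i := by
  rintro ⟨q, hq⟩
  obtain ⟨r, hr⟩ := h
  rw [hq] at hr
  cases hr

theorem arrAt_or_invAt {w : Word Q} {i : ℤ} (h : w.letter i ≠ none) : w.ArrAt i ∨ w.InvAt i := by
  obtain ⟨α, hα⟩ := Option.ne_none_iff_exists'.1 h
  cases α with
  | arr q => exact Or.inl ⟨q, hα⟩
  | inv q => exact Or.inr ⟨q, hα⟩

theorem ArrAt.factorRight {w : Word Q} {i : ℤ} (h : w.ArrAt i) : w.FactorRight i := by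
  intro β hβ
  obtain ⟨q, hq⟩ := h
  rw [hq] at hβ
  cases hβ
  exact ⟨q, rfl⟩

theorem InvAt.factorLeft {w : Word Q} {i : ℤ} (h : w.InvAt (i - 1)) : w.FactorLeft i := by
  intro β hβ
  obtain ⟨q, hq⟩ := h
  rw [hq] at hβ
  cases hβ
  exact ⟨q, rfl⟩

theorem FactorLeft.invAt {w : Word Q} {i : ℤ} (h : w.FactorLeft i) (hn : w.letter (i - 1) ≠ none) :
    w.InvAt (i - 1) := by
  obtain ⟨α, hα⟩ := Option.ne_none_iff_exists'.1 hn
  obtain ⟨q, rfl⟩ := h α hα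
  exact ⟨q, hα⟩

theorem FactorRight.arrAt {w : Word Q} {i : ℤ} (h : w.FactorRight i) (hn : w.letter i ≠ none) :
    w.ArrAt i := by
  obtain ⟨α, hα⟩ := Option.ne_none_iff_exists'.1 hn
  obtain ⟨q, rfl⟩ := h α hα
  exact ⟨q, hα⟩

theorem arrAt_rev {w : Word Q} {i : ℤ} : w.rev.ArrAt i ↔ w.InvAt (-1 - i) := by
  simp only [ArrAt, InvAt, rev_letter_eq_some, Letter.flip]

theorem invAt_rev {w : Word Q} {i : ℤ} : w.rev.InvAt i ↔ w.ArrAt (-1 - i) := by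
  simp only [ArrAt, InvAt, rev_letter_eq_some, Letter.flip]

theorem ArrAt.congr {w v : Word Q} {i j : ℤ} (h : w.ArrAt i) (e : v.letter j = w.letter i) :
    v.ArrAt j := by
  rwa [ArrAt, e]

theorem InvAt.congr {w v : Word Q} {i j : ℤ} (h : w.InvAt i) (e : v.letter j = w.letter i) :
    v.InvAt j := by
  rwa [InvAt, e]

end Word

namespace Blossoming

variable {V : Type u₁} {A : Type u₂} {V' : Type u₃} {A' : Type u₄}
  {Q : GentleQuiver V A} {Q' : GentleQuiver V' A'}

/-- The string of the subwalk of `w` between the cuts `a` and `b` belongs to `T`. -/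
def SegIn (B : Blossoming Q Q') (T : Set (Str Q')) (w : Word Q') (a b : ℤ) : Prop :=
  ∃ x ∈ T, B.Seg w a b x

variable {B : Blossoming Q Q'} {T : Set (Str Q')}

theorem SegIn.mem {w : Word Q'} {a b : ℤ} {x : Str Q'} (h : B.SegIn T w a b)
    (hx : B.Seg w a b x) : x ∈ T := by
  obtain ⟨y, hy, hy'⟩ := h
  rwa [hx.unique hy']

theorem SegIn.rev {w : Word Q'} {a b : ℤ} (h : B.SegIn T w a b) : B.SegIn T w.rev (-b) (-a) := by
  obtain ⟨x, hx, hs⟩ := h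
  exact ⟨x, hx, hs.rev⟩

theorem SegIn.factor (hT : B.IsTorsionSet T) {w : Word Q'} {a b c d : ℤ} (h : B.SegIn T w a b)
    (hac : a ≤ c) (hcd : c ≤ d) (hdb : d ≤ b) (hc : c = a ∨ w.FactorLeft c)
    (hd : d = b ∨ w.FactorRight d) : B.SegIn T w c d := by
  obtain ⟨x, hx, hs⟩ := h
  obtain ⟨y, hy⟩ := exists_seg hcd (hs.2.1.mid hs.2.2.1 hac (hcd.trans hdb))
    (hs.2.1.mid hs.2.2.1 (hac.trans hcd) hdb)
  obtain ⟨-, -, -, γ, rfl, ho⟩ := id hs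
  refine ⟨y, hT.1 _ hx y (hy.isFactor ho ?_ ?_ (hc.imp_left ?_) (hd.imp_left ?_)), hy⟩
  · rintro _ ⟨⟩
    exact hac
  · rintro _ ⟨⟩
    exact hdb
  · rintro rfl
    rfl
  · rintro rfl
    rfl

theorem SegIn.extension (hT : B.IsTorsionSet T) {w : Word Q'} {a k b : ℤ} (h : B.SegIn T w a k)
    (hk : w.ArrAt k) (h' : B.SegIn T w (k + 1) b) : B.SegIn T w a b := by
  obtain ⟨x, hx, hs⟩ := h
  obtain ⟨y, hy, ht⟩ := h'
  obtain ⟨q', hq'⟩ := hk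
  have hak := hs.1
  have hkb := ht.1
  have hab : a < b := by omega
  obtain ⟨q, rfl⟩ := B.mem_range_arrow (hs.2.2.1.2.2 _ hq')
    (ht.2.1.2.1 (Letter.arr q') (by rwa [add_sub_cancel_right]))
  have hsl := (seg_iff_slice hab hs.2.1 ht.2.2.1).2 rfl
  refine ⟨_, hT.2 x hx y hy _ ?_, hsl⟩
  set v := w.slice a b ⟨a, le_rfl, hab, hs.2.1.letter_ne_none ht.2.2.1 le_rfl hab⟩
  have hvw : ∀ i, a ≤ i → i < b → v.letter i = w.letter i := fun i h1 h2 => Word.slice_letter h1 h2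
  obtain ⟨-, -, -, γ, hγ, hγ'⟩ : B.Seg v a k x := hs.congr (fun i h1 h2 => hvw i h1 (by omega))
    fun _ => Or.inr ⟨hvw _ le_rfl hab, hs.2.1.letter_ne_none ht.2.2.1 le_rfl hab⟩
  obtain ⟨-, -, -, δ, hδ, hδ'⟩ : B.Seg v (k + 1) b y := by
    refine ht.congr (fun i h1 h2 => hvw i (by omega) h2) fun _ => Or.inl ?_
    rw [add_sub_cancel_right]
    exact ⟨hvw k hak (by omega), hs.2.1.letter_ne_none ht.2.2.1 hak (by omega)⟩
  refine ⟨v, k, q, γ, δ, some a, some b, rfl, hγ, hδ, (hvw k hak (by omega)).trans hq', hγ', ?_,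
    hδ', ?_⟩
  · exact Word.slice_letter_eq_none (by omega)
  · exact Word.slice_letter_eq_none (by omega)

theorem SegIn.extension_inv (hT : B.IsTorsionSet T) {w : Word Q'} {a k b : ℤ}
    (h : B.SegIn T w a k) (hk : w.InvAt k) (h' : B.SegIn T w (k + 1) b) : B.SegIn T w a b := by
  have h1 := h'.rev
  have h2 := h.rev
  have h3 : w.rev.ArrAt (-(k + 1)) := by
    rw [Word.arrAt_rev]
    rwa [show -1 - -(k + 1) = k by ring]
  have h4 := (h1.extension hT h3 (by rwa [show -(k + 1) + 1 = -k by ring])).rev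
  rwa [Word.rev_rev, neg_neg, neg_neg] at h4

/-- A confined factor of an extension is a factor of one of the two given strings, or it is itself
an extension of factors of them. -/
theorem exists_of_isFactor_extension {x y z t : Str Q'} (h : B.IsExtension x y z)
    (ht : B.IsConfined t) (htz : t.IsFactor z) :
    t.IsFactor x ∨ t.IsFactor y ∨ ∃ w c k d x' y', x'.IsFactor x ∧ y'.IsFactor y ∧
      w.ArrAt k ∧ B.Seg w c k x' ∧ B.Seg w (k + 1) d y' ∧ B.Seg w c d t := by
  obtain ⟨w, k, q, γ, δ, a, b, rfl, rfl, rfl, hk, hγ, ha, hδ, hb⟩ := h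
  obtain ⟨c, d, hs, hc, hd⟩ := exists_seg_of_isFactor ht htz
  have hk' : w.ArrAt k := ⟨_, hk⟩
  -- the word `w` does not extend beyond the walk `γ` on the left and `δ` on the right
  have ha' : ∀ l ∈ a, l ≤ c := by
    rintro l rfl
    have hl : l ≤ k := by
      cases γ with
      | stat q r hqr =>
        obtain ⟨m, h1, h2, -⟩ := hγ
        cases h1
        cases h2
        exact le_rfl
      | word v =>
        obtain ⟨v', -, hp⟩ := Word.exists_isPart hγ
        obtain ⟨i, hi⟩ := v'.nonempty
        obtain ⟨α, hα⟩ := Option.ne_none_iff_exists'.1 hi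
        obtain ⟨-, h1, h2⟩ := (hp _ _).1 hα
        have := h1 l rfl
        have := h2 k rfl
        omega
    by_contra hlt
    have hn : w.letter (l - 1) = none := ha
    rcases hs.2.1.1 with hn' | hn'
    · exact w.letter_ne_none hn' hk'.ne_none (by omega) (by omega) hn
    · exact w.letter_ne_none hn' hk'.ne_none (by omega) (by omega) hn
  have hb' : ∀ l ∈ b, d ≤ l := by
    rintro l rfl
    have hl : k + 1 ≤ l := by
      cases δ with
      | stat q r hqr =>
        obtain ⟨m, h1, h2, -⟩ := hδ
        cases h1
        cases h2
        exact le_rfl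
      | word v =>
        obtain ⟨v', -, hp⟩ := Word.exists_isPart hδ
        obtain ⟨i, hi⟩ := v'.nonempty
        obtain ⟨α, hα⟩ := Option.ne_none_iff_exists'.1 hi
        obtain ⟨-, h1, h2⟩ := (hp _ _).1 hα
        have := h1 (k + 1) rfl
        have := h2 l rfl
        omega
    by_contra hlt
    have hn : w.letter l = none := hb
    rcases hs.2.2.1.1 with hn' | hn'
    · exact w.letter_ne_none hk'.ne_none hn' (by omega) (by omega) hn
    · exact w.letter_ne_none hk'.ne_none hn' (by omega) (by omega) hn
  have hcd := hs.1
  rcases le_or_gt d k with hdk | hdk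
  · refine Or.inl (hs.isFactor hγ ha' ?_ (Or.inr hc) (Or.inr hd))
    rintro _ ⟨⟩
    exact hdk
  rcases lt_or_ge k c with hck | hck
  · refine Or.inr (Or.inl (hs.isFactor hδ ?_ hb' (Or.inr hc) (Or.inr hd)))
    rintro _ ⟨⟩
    exact hck
  obtain ⟨x', hx'⟩ := exists_seg hck hs.2.1 (hs.2.1.mid hs.2.2.1 hck hdk.le)
  obtain ⟨y', hy'⟩ := exists_seg (w := w) (a := k + 1) (b := d) hdk
    (hs.2.1.mid hs.2.2.1 (by omega) hdk) hs.2.2.1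
  refine Or.inr (Or.inr ⟨w, c, k, d, x', y', hx'.isFactor hγ ha' ?_ (Or.inr hc) (Or.inl rfl),
    hy'.isFactor hδ ?_ hb' (Or.inl rfl) (Or.inr hd), hk', hx', hy', hs⟩)
  · rintro _ ⟨⟩
    exact le_rfl
  · rintro _ ⟨⟩
    exact le_rfl

/-- For a torsion set `T`, also `L(T)` is a torsion set. -/
theorem isTorsionSet_lift (hT : B.IsTorsionSet T) : B.IsTorsionSet (B.lift T) := by
  constructor
  · intro x hx y hy z hz
    exact hx ⟨isFactor_trans hz.2 hz.1 hy, hz.2⟩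
  · intro x hx y hy z hz t ht
    rcases exists_of_isFactor_extension hz ht.2 ht.1 with h | h | h
    · exact hx ⟨h, ht.2⟩
    · exact hy ⟨h, ht.2⟩
    · obtain ⟨w, c, k, d, x', y', h1, h2, hk, h3, h4, h5⟩ := h
      exact (SegIn.extension hT ⟨x', hx ⟨h1, h3.confined⟩, h3⟩ hk
        ⟨y', hy ⟨h2, h4.confined⟩, h4⟩).mem h5

theorem isTorsionSet_torsInf (B : Blossoming Q Q') (S : Set (Str Q')) :
    B.IsTorsionSet (B.torsInf S) := by
  constructor
  · intro x hx y hy M hM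
    exact hM.1.1 x (hx M hM) y hy
  · intro x hx y hy z hz M hM
    exact hM.1.2 x (hx M hM) y (hy M hM) z hz

theorem subset_torsInf (B : Blossoming Q Q') (S : Set (Str Q')) : S ⊆ B.torsInf S :=
  fun _ hx _ hM => hM.2 hx

theorem torsGen_mem_tors (B : Blossoming Q Q') (S : Set (Str Q')) : B.torsGen S ∈ B.tors := by
  obtain ⟨h1, h2⟩ := B.isTorsionSet_torsInf S
  refine ⟨⟨?_, ?_⟩, fun x hx => hx.2⟩
  · intro x hx y hy
    exact ⟨h1 x hx.1 y hy, isConfined_of_isFactor hx.2 hy⟩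
  · intro x hx y hy z hz
    exact ⟨h2 x hx.1 y hy.1 z hz, isConfined_of_isExtension hx.2 hy.2 hz⟩

/-- The maps `T` and `L` form a Galois connection. -/
theorem torsGen_subset_iff {S : Set (Str Q')} (hT : B.IsTorsionSet T) :
    B.torsGen S ⊆ T ↔ S ⊆ B.lift T := by
  constructor
  · intro h x hx y hy
    exact h ⟨(B.isTorsionSet_torsInf S).1 x (B.subset_torsInf S hx) y hy.1, hy.2⟩
  · intro h x hx
    exact hx.1 _ ⟨isTorsionSet_lift hT, h⟩ ⟨Or.inl rfl, hx.2⟩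

end Blossoming

/-! ### Crossings -/

namespace Blossoming

variable {V : Type u₁} {A : Type u₂} {V' : Type u₃} {A' : Type u₄}
  {Q : GentleQuiver V A} {Q' : GentleQuiver V' A'}

/-- The string `t` is a factor of `x` with adjacent letters on both sides: `x` is the string of
`γ₁ q⁻ ω r γ₂` and `t` is the string of `ω`. -/
def InnerFactor (B : Blossoming Q Q') (x t : Str Q') : Prop :=
  ∃ (w : Word Q') (a b : ℤ), (Walk.word w).str = x ∧ B.Seg w a b t ∧ w.InvAt (a - 1) ∧ w.ArrAt b

/-- The string `t` is a subobject of `x` with adjacent letters on both sides: `x` is the string of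
`γ₁ q ω r⁻ γ₂` and `t` is the string of `ω`. -/
def InnerSub (B : Blossoming Q Q') (x t : Str Q') : Prop :=
  ∃ (w : Word Q') (a b : ℤ), (Walk.word w).str = x ∧ B.Seg w a b t ∧ w.ArrAt (a - 1) ∧ w.InvAt b

variable {B : Blossoming Q Q'}

theorem innerFactor_str_iff {w : Word Q'} {t : Str Q'} : B.InnerFactor (Walk.word w).str t ↔
    ∃ a b, B.Seg w a b t ∧ w.InvAt (a - 1) ∧ w.ArrAt b := by
  constructor
  · rintro ⟨v, a, b, hv, h⟩
    refine Word.of_str_eq (P := fun w => ∃ a b, B.Seg w a b t ∧ w.InvAt (a - 1) ∧ w.ArrAt b)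
      ?_ ?_ hv ⟨a, b, h⟩
    · rintro u n ⟨a, b, h1, h2, h3⟩
      exact ⟨a - n, b - n, h1.shift n, h2.congr (by rw [Word.shift_letter]; congr 1; ring),
        h3.congr (by rw [Word.shift_letter]; congr 1; ring)⟩
    · rintro u ⟨a, b, h1, h2, h3⟩
      refine ⟨-b, -a, h1.rev, ?_, ?_⟩
      · rwa [Word.invAt_rev, show -1 - (-b - 1) = b by ring]
      · rwa [Word.arrAt_rev, show -1 - -a = a - 1 by ring]
  · rintro ⟨a, b, h⟩
    exact ⟨w, a, b, rfl, h⟩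

theorem innerSub_str_iff {w : Word Q'} {t : Str Q'} : B.InnerSub (Walk.word w).str t ↔
    ∃ a b, B.Seg w a b t ∧ w.ArrAt (a - 1) ∧ w.InvAt b := by
  constructor
  · rintro ⟨v, a, b, hv, h⟩
    refine Word.of_str_eq (P := fun w => ∃ a b, B.Seg w a b t ∧ w.ArrAt (a - 1) ∧ w.InvAt b)
      ?_ ?_ hv ⟨a, b, h⟩
    · rintro u n ⟨a, b, h1, h2, h3⟩
      exact ⟨a - n, b - n, h1.shift n, h2.congr (by rw [Word.shift_letter]; congr 1; ring),
        h3.congr (by rw [Word.shift_letter]; congr 1; ring)⟩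
    · rintro u ⟨a, b, h1, h2, h3⟩
      refine ⟨-b, -a, h1.rev, ?_, ?_⟩
      · rwa [Word.arrAt_rev, show -1 - (-b - 1) = b by ring]
      · rwa [Word.invAt_rev, show -1 - -a = a - 1 by ring]
  · rintro ⟨a, b, h⟩
    exact ⟨w, a, b, rfl, h⟩

theorem InnerFactor.isConfined {x t : Str Q'} (h : B.InnerFactor x t) : B.IsConfined t := by
  obtain ⟨_, _, _, _, h, _⟩ := h
  exact h.confined

theorem InnerSub.isConfined {x t : Str Q'} (h : B.InnerSub x t) : B.IsConfined t := by
  obtain ⟨_, _, _, _, h, _⟩ := h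
  exact h.confined

theorem InnerFactor.isFactor {x t : Str Q'} (h : B.InnerFactor x t) : t.IsFactor x := by
  obtain ⟨w, a, b, rfl, h, ha, hb⟩ := h
  exact h.isFactor_str ha.factorLeft hb.factorRight

/-- Two segments with the same string can be aligned by shifting one of the words, or its inverse:
then they are occurrences of the same walk between the same cuts. -/
theorem exists_aligned {w v : Word Q'} {c d e f : ℤ} {t : Str Q'} (hw : B.Seg w c d t)
    (hv : B.Seg v e f t) : ∃ (v' : Word Q') (ω : Walk Q'),
      d - c = f - e ∧ (v' = v.shift (e - c) ∨ v' = v.rev.shift (-f - c)) ∧ ω.str = t ∧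
      w.OccursAt (some c) (some d) ω ∧ v'.OccursAt (some c) (some d) ω ∧
      ∀ i, c ≤ i → i < d → v'.letter i = w.letter i := by
  rcases hw.1.eq_or_lt with rfl | hcd
  · obtain ⟨-, -, -, ω₁, rfl, hω₁⟩ := hw
    obtain ⟨-, -, -, ω₂, hω, hω₂⟩ := id hv
    obtain ⟨q, r, hqr, rfl⟩ : ∃ q r h, ω₁ = Walk.stat q r h := by
      cases ω₁ with
      | stat q r hqr => exact ⟨q, r, hqr, rfl⟩
      | word u =>
        obtain ⟨m, hm⟩ := hω₁
        obtain ⟨i, hi⟩ := u.nonempty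
        obtain ⟨α, hα⟩ := Option.ne_none_iff_exists'.1 hi
        obtain ⟨-, h1, h2⟩ := (hm i α).1 hα
        exact absurd (h2 c rfl) (h1 c rfl).not_gt
    cases ω₂ with
    | word u => exact absurd hω.symm Word.str_stat_ne_str_word
    | stat q' r' hqr' =>
      obtain ⟨k, h1, h2, -⟩ := id hω₂
      cases h1
      cases h2
      rcases Quotient.exact hω with h | h
      · obtain ⟨rfl, rfl⟩ := h
        refine ⟨_, _, by ring, Or.inl rfl, rfl, hω₁, ?_, fun i h1 h2 => by omega⟩
        have := hω₂.shift (e - c)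
        rwa [sub_sub_cancel] at this
      · refine ⟨_, _, by ring, Or.inr rfl, rfl, hω₁, ?_, fun i h1 h2 => by omega⟩
        have := (occursAt_rev_stat (h' := hqr) h.1 h.2 hω₂).shift (-e - c)
        rwa [sub_sub_cancel] at this
  · have hef : e < f := by
      refine lt_of_le_of_ne hv.1 ?_
      rintro rfl
      obtain ⟨q, r, hqr, h, -⟩ := (seg_self_iff hv.2.1).1 hv
      rw [← (seg_iff_slice hcd hw.2.1 hw.2.2.1).1 hw] at h
      exact Word.str_stat_ne_str_word h
    have h1 := (seg_iff_slice hcd hw.2.1 hw.2.2.1).1 hw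
    have h2 := (seg_iff_slice hef hv.2.1 hv.2.2.1).1 hv
    have hne1 : ∀ i, c ≤ i → i < d → w.letter i ≠ none := fun i => hw.2.1.letter_ne_none hw.2.2.1
    have hne2 : ∀ i, e ≤ i → i < f → v.letter i ≠ none := fun i => hv.2.1.letter_ne_none hv.2.2.1
    set w₁ := w.slice c d ⟨c, le_rfl, hcd, hw.2.1.letter_ne_none hw.2.2.1 le_rfl hcd⟩
    set v₁ := v.slice e f ⟨e, le_rfl, hef, hv.2.1.letter_ne_none hv.2.2.1 le_rfl hef⟩
    have hw₁ : ∀ i α, w₁.letter i = some α ↔ w.letter i = some α ∧ c ≤ i ∧ i < d :=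
      fun i α => Word.slice_letter_eq_some
    have hv₁ : ∀ i α, v₁.letter i = some α ↔ v.letter i = some α ∧ e ≤ i ∧ i < f :=
      fun i α => Word.slice_letter_eq_some
    have supp1 : ∀ i, w₁.letter i ≠ none ↔ c ≤ i ∧ i < d := by
      intro i
      rw [Option.ne_none_iff_exists']
      constructor
      · rintro ⟨α, hα⟩
        exact ((hw₁ i α).1 hα).2
      · intro hi
        obtain ⟨α, hα⟩ := Option.ne_none_iff_exists'.1 (hne1 i hi.1 hi.2)
        exact ⟨α, (hw₁ i α).2 ⟨hα, hi⟩⟩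
    have supp2 : ∀ i, v₁.letter i ≠ none ↔ e ≤ i ∧ i < f := by
      intro i
      rw [Option.ne_none_iff_exists']
      constructor
      · rintro ⟨α, hα⟩
        exact ((hv₁ i α).1 hα).2
      · intro hi
        obtain ⟨α, hα⟩ := Option.ne_none_iff_exists'.1 (hne2 i hi.1 hi.2)
        exact ⟨α, (hv₁ i α).2 ⟨hα, hi⟩⟩
    have key : ∃ v' : Word Q', d - c = f - e ∧
        (v' = v.shift (e - c) ∨ v' = v.rev.shift (-f - c)) ∧
        ∀ i, c ≤ i → i < d → v'.letter i = w.letter i := by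
      obtain ⟨n, h | h⟩ := Word.eq_shift_or_eq_rev_shift (h1.trans h2.symm)
      · have hs : ∀ i, (e ≤ i ∧ i < f) ↔ (c ≤ i + n ∧ i + n < d) := fun i => by
          rw [← supp1, ← supp2, h, Word.shift_letter]
        have e1 := hs e
        have e2 := hs (f - 1)
        have e3 := hs (c - n)
        have e4 := hs (d - 1 - n)
        refine ⟨v.shift (e - c), by omega, Or.inl rfl, fun i hi hi' => ?_⟩
        obtain ⟨α, hα⟩ := Option.ne_none_iff_exists'.1 (hne1 i hi hi')
        have h3 : v₁.letter (i + (e - c)) = some α := by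
          rw [h, Word.shift_letter, show i + (e - c) + n = i by omega]
          exact (hw₁ i α).2 ⟨hα, hi, hi'⟩
        rw [Word.shift_letter, hα]
        exact ((hv₁ _ _).1 h3).1
      · have hs : ∀ i, (e ≤ i ∧ i < f) ↔ (c ≤ -1 - (i + n) ∧ -1 - (i + n) < d) := fun i => by
          rw [← supp1, ← supp2, h, Word.shift_letter, Word.rev_letter_ne_none]
        have e1 := hs e
        have e2 := hs (f - 1)
        have e3 := hs (-1 - c - n)
        have e4 := hs (-d - n)
        refine ⟨v.rev.shift (-f - c), by omega, Or.inr rfl, fun i hi hi' => ?_⟩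
        obtain ⟨α, hα⟩ := Option.ne_none_iff_exists'.1 (hne1 i hi hi')
        have h3 : v₁.letter (-1 - (i + (-f - c))) = some α.flip := by
          rw [h, Word.shift_letter, Word.rev_letter_eq_some, Letter.flip_flip,
            show -1 - (-1 - (i + (-f - c)) + n) = i by omega]
          exact (hw₁ i α).2 ⟨hα, hi, hi'⟩
        rw [Word.shift_letter, hα, Word.rev_letter_eq_some]
        exact ((hv₁ _ _).1 h3).1
    obtain ⟨v', h3, h4, h5⟩ := key
    refine ⟨v', Walk.word w₁, h3, h4, h1, ⟨0, fun i α => ?_⟩, ⟨0, fun i α => ?_⟩, h5⟩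
    · simpa using hw₁ i α
    · rw [hw₁]
      simp only [add_zero, Option.mem_def, Option.some.injEq, forall_eq']
      exact and_congr_left fun hi => by rw [h5 i hi.1 hi.2]

/-- If the string of a segment of `w` is an inner subobject of `y`, then `y` is the string of a word
in which this subobject sits at the same place as the segment does in `w`. -/
theorem InnerSub.exists_aligned {w : Word Q'} {c d : ℤ} {t y : Str Q'} (h : B.InnerSub y t)
    (hw : B.Seg w c d t) : ∃ (v : Word Q') (ω : Walk Q'), (Walk.word v).str = y ∧
      w.OccursAt (some c) (some d) ω ∧ v.OccursAt (some c) (some d) ω ∧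
      (∀ i, c ≤ i → i < d → v.letter i = w.letter i) ∧ v.ArrAt (c - 1) ∧ v.InvAt d := by
  obtain ⟨v, e, f, rfl, hv, he, hf⟩ := h
  obtain ⟨v', ω, h1, h2 | h2, rfl, h3, h4, h5⟩ := Blossoming.exists_aligned hw hv
  · refine ⟨v', ω, h2 ▸ Word.str_shift _ _, h3, h4, h5, he.congr ?_, hf.congr ?_⟩ <;>
    · rw [h2, Word.shift_letter]
      congr 1
      omega
  · refine ⟨v', ω, h2 ▸ (Word.str_shift _ _).trans (Word.str_rev _), h3, h4, h5, ?_, ?_⟩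
    · refine Word.ArrAt.congr (w := v.rev) (i := -f - 1) ?_ ?_
      · rwa [Word.arrAt_rev, show -1 - (-f - 1) = f by ring]
      · rw [h2, Word.shift_letter]
        congr 1
        omega
    · refine Word.InvAt.congr (w := v.rev) (i := -e) ?_ ?_
      · rwa [Word.invAt_rev, show -1 - -e = e - 1 by ring]
      · rw [h2, Word.shift_letter]
        congr 1
        omega

/-- A positive crossing is a confined string that is an inner factor of the first and an inner
subobject of the second string. -/
theorem posCross_iff (B : Blossoming Q Q') {x y : Str Q'} :
    x.PosCross y ↔ ∃ t, B.InnerFactor x t ∧ B.InnerSub y t := by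
  constructor
  · rintro ⟨w, v, rfl, rfl, ω, a, b, c, d, q, q', r, r', h1, h2, h3, h4, h5, h6⟩
    obtain ⟨a, rfl⟩ : ∃ a', a = some a' := by
      cases a with
      | none => cases h2
      | some a => exact ⟨a, rfl⟩
    obtain ⟨b, rfl⟩ : ∃ b', b = some b' := by
      cases b with
      | none => cases h3
      | some b => exact ⟨b, rfl⟩
    obtain ⟨c, rfl⟩ : ∃ c', c = some c' := by
      cases c with
      | none => cases h5
      | some c => exact ⟨c, rfl⟩
    obtain ⟨d, rfl⟩ : ∃ d', d = some d' := by
      cases d with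
      | none => cases h6
      | some d => exact ⟨d, rfl⟩
    have key : ∀ (u : Word Q') (a b : ℤ), u.OccursAt (some a) (some b) ω →
        u.letter (a - 1) ≠ none → u.letter b ≠ none → B.Seg u a b ω.str := by
      intro u a b ho ha hb
      have hlt : a ≤ b ∧ B.Cut u a ∧ B.Cut u b := by
        cases ω with
        | stat q r hqr =>
          obtain ⟨k, e1, e2, -⟩ := ho
          cases e1
          cases e2
          exact ⟨le_rfl, B.cut_of_ne_none ha hb, B.cut_of_ne_none ha hb⟩
        | word z =>
          obtain ⟨m, hm⟩ := ho
          obtain ⟨i, hi⟩ := z.nonempty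
          obtain ⟨α, hα⟩ := Option.ne_none_iff_exists'.1 hi
          obtain ⟨-, e1, e2⟩ := (hm i α).1 hα
          have e1 := e1 a rfl
          have e2 := e2 b rfl
          exact ⟨by omega, B.cut_of_ne_none ha (u.letter_ne_none ha hb (by omega) (by omega)),
            B.cut_of_ne_none (u.letter_ne_none ha hb (by omega) (by omega)) hb⟩
      exact ⟨hlt.1, hlt.2.1, hlt.2.2, ω, rfl, ho⟩
    have h2 : w.InvAt (a - 1) := ⟨q, h2⟩
    have h3 : w.ArrAt b := ⟨q', h3⟩
    have h5 : v.ArrAt (c - 1) := ⟨r, h5⟩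
    have h6 : v.InvAt d := ⟨r', h6⟩
    exact ⟨ω.str, ⟨w, a, b, rfl, key w a b h1 h2.ne_none h3.ne_none, h2, h3⟩,
      ⟨v, c, d, rfl, key v c d h4 h5.ne_none h6.ne_none, h5, h6⟩⟩
  · rintro ⟨t, ⟨w, a, b, hw, hs, ⟨q, hq⟩, ⟨q', hq'⟩⟩, h⟩
    obtain ⟨v, ω, hv, h1, h2, -, ⟨r, hr⟩, ⟨r', hr'⟩⟩ := h.exists_aligned hs
    exact ⟨w, v, hw, hv, ω, some a, some b, some a, some b, q, q', r, r', h1, hq, hq', h2, hr, hr'⟩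

theorem IsInfinite.innerFactor {x t : Str Q'} (hx : B.IsInfinite x) (ht : B.IsConfined t)
    (h : t.IsFactor x) : B.InnerFactor x t := by
  obtain ⟨w, rfl, hw⟩ := exists_infWord hx
  obtain ⟨c, d, hs, hc, hd⟩ := exists_seg_of_isFactor ht h
  exact ⟨w, c, d, rfl, hs, hc.invAt (hw c hs.2.1).1, hd.arrAt (hw d hs.2.2.1).2⟩

theorem mem_lift_iff_of_isInfinite {T : Set (Str Q')} {x : Str Q'} (hx : B.IsInfinite x) :
    x ∈ B.lift T ↔ ∀ t, B.InnerFactor x t → t ∈ T :=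
  ⟨fun h _ ht => h ⟨ht.isFactor, ht.isConfined⟩, fun h t ht => h t (hx.innerFactor ht.2 ht.1)⟩

/-- The confined strings none of whose factors is an inner subobject of `x`. -/
def subFree (B : Blossoming Q Q') (x : Str Q') : Set (Str Q') :=
  {s | B.IsConfined s ∧ ∀ t, t.IsFactor s → ¬ B.InnerSub x t}

/-- The crucial case is that of an inner subobject `α q β` of `x` with an arrow `q`: then also `β`
is an inner subobject of `x`. -/
theorem subFree_mem_tors (B : Blossoming Q Q') (x : Str Q') : B.subFree x ∈ B.tors := by
  refine ⟨⟨?_, ?_⟩, fun s hs => hs.1⟩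
  · intro s hs y hy
    exact ⟨isConfined_of_isFactor hs.1 hy, fun t ht h =>
      hs.2 t (isFactor_trans h.isConfined ht hy) h⟩
  · intro y hy z hz s hs
    refine ⟨isConfined_of_isExtension hy.1 hz.1 hs, fun t ht h => ?_⟩
    rcases exists_of_isFactor_extension hs h.isConfined ht with h1 | h1 | h1
    · exact hy.2 t h1 h
    · exact hz.2 t h1 h
    · obtain ⟨w, c, k, d, y', z', -, h2, hk, h3, h4, h5⟩ := h1
      obtain ⟨v, ω, rfl, -, -, h6, h7, h8⟩ := h.exists_aligned h5
      have hck := h3.1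
      have hkd := h4.1
      have hvk : v.letter k = w.letter k := h6 k hck (by omega)
      refine hz.2 z' h2 ⟨v, k + 1, d, rfl, ?_, ?_, h8⟩
      · refine h4.congr (fun i h1 h2 => h6 i (by omega) h2) fun _ => Or.inl ?_
        rw [add_sub_cancel_right]
        exact ⟨hvk, hk.ne_none⟩
      · rw [add_sub_cancel_right]
        exact hk.congr hvk

end Blossoming

/-! ### Extending words by a rule -/

/-- A sequence is continued from the index `d` on by a rule for the next value, given all previous
values. -/
theorem exists_continuation {X : Type*} (g₀ : ℤ → Option X) (d : ℤ)
    (step : (ℤ → Option X) → ℤ → Option X) : ∃ g : ℤ → Option X, (∀ j < d, g j = g₀ j) ∧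
      ∀ k ≥ d, g k = step (fun j => if j < k then g j else none) k := by
  let G : ℕ → ℤ → Option X := fun n => Nat.rec (fun j => if j < d then g₀ j else none)
    (fun n h => Function.update h (d + n) (step h (d + n))) n
  have G_succ : ∀ n, G (n + 1) = Function.update (G n) (d + n) (step (G n) (d + n)) := fun _ => rfl
  let g : ℤ → Option X := fun j => if j < d then g₀ j else G ((j - d).toNat + 1) j
  have hg : ∀ n : ℕ, g (d + n) = G (n + 1) (d + n) := by
    intro n
    simp only [g]
    rw [if_neg (by omega), show (d + n - d).toNat = n by omega]
  have hG : ∀ n : ℕ, G n = fun j => if j < d + n then g j else none := by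
    intro n
    induction n with
    | zero =>
      funext j
      by_cases hj : j < d <;> simp [G, g, hj]
    | succ n ih =>
      funext j
      rcases lt_trichotomy j (d + n) with hj | rfl | hj
      · rw [G_succ, Function.update_of_ne hj.ne, ih]
        simp only
        rw [if_pos hj, if_pos (by push_cast; omega)]
      · rw [if_pos (by push_cast; omega), hg]
      · rw [G_succ, Function.update_of_ne hj.ne', ih]
        simp only
        rw [if_neg (by omega), if_neg (by push_cast; omega)]
  refine ⟨g, fun j hj => if_pos hj, fun k hk => ?_⟩
  obtain ⟨n, rfl⟩ : ∃ n : ℕ, k = d + n := ⟨(k - d).toNat, by omega⟩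
  rw [hg, G_succ, Function.update_self, ← hG]

namespace Blossoming

variable {V : Type u₁} {A : Type u₂} {V' : Type u₃} {A' : Type u₄}
  {Q : GentleQuiver V A} {Q' : GentleQuiver V' A'}

theorem exists_nonzero (B : Blossoming Q Q') {α : Letter A'} (h : α.tgt Q' ∈ Set.range B.vert)
    (p : Prop) : ∃ β, α.Nonzero Q' β ∧ (β.IsArrow ↔ p) := by
  by_cases hp : p
  · obtain ⟨r, hr⟩ := B.exists_nonzero_arr h
    exact ⟨_, hr, by simp [hp, Letter.IsArrow]⟩
  · obtain ⟨r, hr⟩ := B.exists_nonzero_inv h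
    exact ⟨_, hr, by simp [hp, Letter.IsArrow]⟩

/-- The part of a word to the left of the cut `d` can be continued to the right until it is
right-infinite, and at each step one may prescribe, in terms of the letters chosen so far, whether
the next letter is an arrow. -/
theorem exists_extension_right (B : Blossoming Q Q') (w : Word Q') (d : ℤ)
    (hd : w.letter (d - 1) ≠ none) (R : Word Q' → ℤ → Prop)
    (hR : ∀ u v k, d ≤ k → u.letter (k - 1) ≠ none → (∀ j < k, v.letter j = u.letter j) →
      R u k → R v k) :
    ∃ v : Word Q', (∀ j < d, v.letter j = w.letter j) ∧ (∀ k, B.Cut v k → v.letter k ≠ none) ∧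
      ∀ k, d ≤ k → v.letter k ≠ none → (v.ArrAt k ↔ R v k) := by
  have hstep : ∀ (g : ℤ → Option (Letter A')) (k : ℤ), ∃ o : Option (Letter A'),
      (∀ β, o = some β → ∃ α, g (k - 1) = some α ∧ α.Nonzero Q' β ∧
        (β.IsArrow ↔ ∃ u : Word Q', (∀ j < k, u.letter j = g j) ∧ R u k)) ∧
      ∀ α, g (k - 1) = some α → α.tgt Q' ∈ Set.range B.vert → o ≠ none := by
    intro g k
    by_cases h : ∃ α, g (k - 1) = some α ∧ α.tgt Q' ∈ Set.range B.vert
    · obtain ⟨α, h1, h2⟩ := h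
      obtain ⟨β, h3, h4⟩ := B.exists_nonzero h2
        (∃ u : Word Q', (∀ j < k, u.letter j = g j) ∧ R u k)
      refine ⟨some β, ?_, fun _ _ _ => by simp⟩
      rintro _ ⟨⟩
      exact ⟨α, h1, h3, h4⟩
    · exact ⟨none, by simp, fun α h1 h2 => absurd ⟨α, h1, h2⟩ h⟩
  choose step hs1 hs2 using hstep
  obtain ⟨g, hg1, hg2⟩ := exists_continuation w.letter d step
  have hprev : ∀ k, d ≤ k → ∀ β, g k = some β → ∃ α, g (k - 1) = some α ∧ α.Nonzero Q' β ∧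
      (β.IsArrow ↔ ∃ u : Word Q', (∀ j < k, u.letter j = g j) ∧ R u k) := by
    intro k hk β hβ
    rw [hg2 k hk] at hβ
    obtain ⟨α, h1, h2, h3⟩ := hs1 _ _ _ hβ
    rw [if_pos (by omega)] at h1
    refine ⟨α, h1, h2, h3.trans (exists_congr fun u => and_congr_left' ?_)⟩
    refine forall₂_congr fun j hj => ?_
    rw [if_pos hj]
  have hdown : ∀ n : ℕ, ∀ k, d - 1 ≤ k → g (k + n) ≠ none → g k ≠ none := by
    intro n
    induction n with
    | zero => simp
    | succ n ih =>
      intro k hk hn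
      refine ih k hk ?_
      obtain ⟨β, hβ⟩ := Option.ne_none_iff_exists'.1 hn
      obtain ⟨α, hα, -⟩ := hprev _ (by push_cast; omega) β hβ
      rw [show k + (n : ℤ) = k + (n + 1 : ℕ) - 1 by push_cast; ring, hα]
      simp
  have hd' : g (d - 1) ≠ none := by rwa [hg1 _ (by omega)]
  let v : Word Q' :=
    { letter := g
      nonempty := ⟨d - 1, hd'⟩
      interval := by
        refine ⟨fun i hi k hk j hj => ?_⟩
        rcases le_or_gt (d - 1) j with h | h
        · refine hdown (k - j).toNat j h ?_
          rwa [show j + ((k - j).toNat : ℤ) = k by have := hj.2; omega]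
        · change g j ≠ none
          have hi' : g i ≠ none := hi
          have h1 := hj.1
          rw [hg1 _ (by omega)] at hi' ⊢
          exact w.letter_ne_none hi' hd (by omega) (by omega)
      nonzero := by
        intro i α β hα hβ
        rcases le_or_gt d (i + 1) with h | h
        · obtain ⟨α', h1, h2, -⟩ := hprev _ h β hβ
          rw [add_sub_cancel_right, hα] at h1
          cases h1
          exact h2
        · rw [hg1 _ (by omega)] at hα hβ
          exact w.nonzero i α β hα hβ }
  have hcut : ∀ k, B.Cut v k → v.letter k ≠ none := by
    intro k hk
    rcases le_or_gt d k with h | h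
    · intro hn
      obtain ⟨α, hα⟩ := Option.ne_none_iff_exists'.1 (hk.1.resolve_right (not_not.2 hn))
      refine hs2 (fun j => if j < k then g j else none) k α ?_ (hk.2.1 α hα) ?_
      · rw [if_pos (by omega)]
        exact hα
      · rw [← hg2 k h]
        exact hn
    · rcases hk.1 with h1 | h1
      · exact v.letter_ne_none h1 hd' (by omega) (by omega)
      · exact h1
  refine ⟨v, hg1, hcut, fun k hk hn => ?_⟩
  obtain ⟨β, hβ⟩ := Option.ne_none_iff_exists'.1 hn
  obtain ⟨α, hα, -, h⟩ := hprev k hk β hβ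
  have hn' : v.letter (k - 1) ≠ none := by
    change g (k - 1) ≠ none
    simp [hα]
  have h1 : v.ArrAt k ↔ β.IsArrow := by
    simp only [Word.ArrAt, hβ, Letter.IsArrow, Option.some.injEq]
  rw [h1, h]
  constructor
  · rintro ⟨u, hu, hR'⟩
    exact hR u v k hk ((hu _ (by omega)).trans_ne hn') (fun j hj => (hu j hj).symm) hR'
  · exact fun h => ⟨v, fun _ _ => rfl, h⟩

/-- The part of a word to the right of the cut `c` can be continued to the left until it is
left-infinite, and at each step one may prescribe, in terms of the letters chosen so far, whether
the next letter is an inverse arrow. -/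
theorem exists_extension_left (B : Blossoming Q Q') (w : Word Q') (c : ℤ)
    (hc : w.letter c ≠ none) (R : Word Q' → ℤ → Prop)
    (hR : ∀ u v k, k ≤ c → u.letter k ≠ none → (∀ j ≥ k, v.letter j = u.letter j) →
      R u k → R v k) :
    ∃ v : Word Q', (∀ j ≥ c, v.letter j = w.letter j) ∧
      (∀ k, B.Cut v k → v.letter (k - 1) ≠ none) ∧
      ∀ k, k ≤ c → v.letter (k - 1) ≠ none → (v.InvAt (k - 1) ↔ R v k) := by
  obtain ⟨v, h1, h2, h3⟩ := B.exists_extension_right w.rev (-c)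
    (by rwa [Word.rev_letter_ne_none, show -1 - (-c - 1) = c by ring])
    (fun u k => R u.rev (-k)) (by
      intro u v k hk hn h
      refine hR _ _ _ (by omega) ?_ fun j hj => ?_
      · rwa [Word.rev_letter_ne_none, show -1 - -k = k - 1 by ring]
      · rw [Word.rev_letter, Word.rev_letter, h _ (by omega)])
  refine ⟨v.rev, fun j hj => ?_, fun k hk => ?_, fun k hk hn => ?_⟩
  · conv_rhs => rw [← w.rev_rev]
    rw [Word.rev_letter, Word.rev_letter w.rev, h1 _ (by omega)]
  · have := h2 (-k) (by simpa [Word.rev_rev] using hk.rev)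
    rwa [Word.rev_letter_ne_none, show -1 - (k - 1) = -k by ring]
  · rw [Word.rev_letter_ne_none, show -1 - (k - 1) = -k by ring] at hn
    have := h3 (-k) (by omega) hn
    rwa [neg_neg, ← show -1 - (k - 1) = -k by ring, ← Word.invAt_rev] at this

end Blossoming

/-! ### Greedy completions -/

namespace Blossoming

variable {V : Type u₁} {A : Type u₂} {V' : Type u₃} {A' : Type u₄}
  {Q : GentleQuiver V A} {Q' : GentleQuiver V' A'} {B : Blossoming Q Q'} {T : Set (Str Q')}

theorem Seg.congr_of_lt {w v : Word Q'} {a b d : ℤ} {x : Str Q'} (hs : B.Seg w a b x) (hb : b ≤ d)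
    (hd : w.letter (d - 1) ≠ none) (h : ∀ j < d, v.letter j = w.letter j) : B.Seg v a b x := by
  refine hs.congr (fun i _ h2 => h i (by omega)) ?_
  rintro rfl
  rcases hb.eq_or_lt with rfl | hlt
  · exact Or.inl ⟨h _ (by omega), hd⟩
  · exact hs.2.1.1.imp (fun hn => ⟨h _ (by omega), hn⟩) (fun hn => ⟨h _ hlt, hn⟩)

theorem Seg.congr_of_ge {w v : Word Q'} {a b c : ℤ} {x : Str Q'} (hs : B.Seg w a b x) (ha : c ≤ a)
    (hc : w.letter c ≠ none) (h : ∀ j ≥ c, v.letter j = w.letter j) : B.Seg v a b x := by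
  refine hs.congr (fun i h1 _ => h i (by omega)) ?_
  rintro rfl
  rcases ha.eq_or_lt with rfl | hlt
  · exact Or.inr ⟨h _ le_rfl, hc⟩
  · exact hs.2.1.1.imp (fun hn => ⟨h _ (by omega), hn⟩) (fun hn => ⟨h _ ha, hn⟩)

theorem SegIn.congr_of_lt {w v : Word Q'} {a b d : ℤ} (hs : B.SegIn T w a b) (hb : b ≤ d)
    (hd : w.letter (d - 1) ≠ none) (h : ∀ j < d, v.letter j = w.letter j) : B.SegIn T v a b := by
  obtain ⟨x, hx, hs⟩ := hs
  exact ⟨x, hx, hs.congr_of_lt hb hd h⟩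

theorem SegIn.congr_of_ge {w v : Word Q'} {a b c : ℤ} (hs : B.SegIn T w a b) (ha : c ≤ a)
    (hc : w.letter c ≠ none) (h : ∀ j ≥ c, v.letter j = w.letter j) : B.SegIn T v a b := by
  obtain ⟨x, hx, hs⟩ := hs
  exact ⟨x, hx, hs.congr_of_ge ha hc h⟩

/-- All factors of `w` with adjacent letters on both sides belong to `T`. -/
def AllFactorsIn (B : Blossoming Q Q') (T : Set (Str Q')) (w : Word Q') : Prop :=
  ∀ a b, a ≤ b → w.InvAt (a - 1) → w.ArrAt b → B.SegIn T w a b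

/-- The segment of `w` between the cuts `c` and `d` is completed to an infinite word `y`, with the
adjacent letters of a factor if `ε` holds and with those of a subobject otherwise. By `hin` the
factors of `y` inside the segment, which for `ε` may share an end with it, belong to `T`.
The further letters are chosen greedily: to the right an arrow, and to the left an inverse arrow,
whenever this does not create a factor outside `T`. Then a subobject `σ` of `y` that involves such a
further letter cannot belong to `T`: at the letter where `σ` ends, the greedy choice was prevented by a
factor outside `T`, which, however, is a factor of `σ` or an extension involving `σ`. -/
theorem exists_completion (hT : B.IsTorsionSet T) (w : Word Q') {c d : ℤ} (hcd : c ≤ d)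
    (hc : w.letter (c - 1) ≠ none) (hd : w.letter d ≠ none) (ε : Prop)
    (hin : ∀ a b, c ≤ a → a ≤ b → b ≤ d → (a = c ∧ ε ∨ c < a ∧ w.InvAt (a - 1)) →
      (b = d ∧ ε ∨ b < d ∧ w.ArrAt b) → B.SegIn T w a b) :
    ∃ y : Word Q', B.InfWord y ∧ (∀ i, c ≤ i → i < d → y.letter i = w.letter i) ∧
      (∀ a b x, c ≤ a → b ≤ d → (B.Seg w a b x ↔ B.Seg y a b x)) ∧
      (ε → y.InvAt (c - 1) ∧ y.ArrAt d) ∧ (¬ ε → y.ArrAt (c - 1) ∧ y.InvAt d) ∧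
      B.AllFactorsIn T y ∧
      ∀ a b, y.ArrAt (a - 1) → y.InvAt b → a < c ∨ d < b → ¬ B.SegIn T y a b := by
  have hwd : w.letter (d - 1) ≠ none := w.letter_ne_none hc hd (by omega) (by omega)
  -- continuation to the right
  let R₁ : Word Q' → ℤ → Prop := fun u k => (k = d ∧ ε) ∨ (k ≠ d ∧
    ∀ a, c ≤ a → a ≤ k → (a = c ∧ ε ∨ c < a ∧ u.InvAt (a - 1)) → B.SegIn T u a k)
  obtain ⟨v, hv1, hv2, hv3⟩ := B.exists_extension_right w d hwd R₁ (by
    rintro u v k - hn h (⟨h1, h2⟩ | ⟨h1, h2⟩)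
    · exact Or.inl ⟨h1, h2⟩
    · refine Or.inr ⟨h1, fun a h3 h4 h5 => ?_⟩
      refine (h2 a h3 h4 (h5.imp_right (And.imp_right fun h6 => ?_))).congr_of_lt le_rfl hn h
      exact h6.congr (h _ (by omega)).symm)
  have hvd' : v.letter (d - 1) ≠ none := by rwa [hv1 _ (by omega)]
  have hvd : v.letter d ≠ none :=
    hv2 d ((B.cut_of_ne_none hwd hd).congr (Or.inl ⟨hv1 _ (by omega), hwd⟩))
  have hvc' : v.letter (c - 1) ≠ none := by rwa [hv1 _ (by omega)]
  have hvc : v.letter c ≠ none := v.letter_ne_none hvc' hvd (by omega) hcd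
  -- continuation to the left
  let R₂ : Word Q' → ℤ → Prop := fun u k => (k = c ∧ ε) ∨ (k ≠ c ∧
    ∀ b, k ≤ b → u.ArrAt b → B.SegIn T u k b)
  obtain ⟨y, hy1, hy2, hy3⟩ := B.exists_extension_left v c hvc R₂ (by
    rintro u v k - hn h (⟨h1, h2⟩ | ⟨h1, h2⟩)
    · exact Or.inl ⟨h1, h2⟩
    · exact Or.inr ⟨h1, fun b h3 h4 => (h2 b h3 (h4.congr (h _ h3).symm)).congr_of_ge le_rfl hn h⟩)
  have hyc : y.letter c ≠ none := by rwa [hy1 _ le_rfl]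
  have hyd : y.letter d ≠ none := by rwa [hy1 _ hcd]
  have hyc' : y.letter (c - 1) ≠ none :=
    hy2 c ((B.cut_of_ne_none hvc' hvc).congr (Or.inr ⟨hy1 _ le_rfl, hvc⟩))
  have hyw : ∀ i, c ≤ i → i < d → y.letter i = w.letter i := fun i h1 h2 =>
    (hy1 i h1).trans (hv1 i h2)
  have hseg : ∀ a b x, c ≤ a → b ≤ d → (B.Seg w a b x ↔ B.Seg y a b x) := fun a b x ha hb =>
    ⟨fun h => (h.congr_of_lt hb hwd hv1).congr_of_ge ha hvc hy1,
      fun h => (h.congr_of_ge ha hyc fun j hj => (hy1 j hj).symm).congr_of_lt hb hvd'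
        fun j hj => (hv1 j hj).symm⟩
  have hεc : y.InvAt (c - 1) ↔ ε := by
    rw [hy3 c le_rfl hyc']
    simp [R₂]
  have hεd : y.ArrAt d ↔ ε := by
    have h1 : v.ArrAt d ↔ ε := by
      rw [hv3 d le_rfl hvd]
      simp [R₁]
    rw [← h1]
    exact ⟨fun h => h.congr (hy1 d hcd).symm, fun h => h.congr (hy1 d hcd)⟩
  have hfac : B.AllFactorsIn T y := by
    intro a b hab ha hb
    rcases lt_or_ge a c with hac | hac
    · rcases (hy3 a hac.le ha.ne_none).1 ha with h | h
      · omega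
      · exact h.2 b hab hb
    have ha' : a = c ∧ ε ∨ c < a ∧ v.InvAt (a - 1) := by
      rcases hac.eq_or_lt with rfl | hlt
      · exact Or.inl ⟨rfl, hεc.1 ha⟩
      · exact Or.inr ⟨hlt, ha.congr (hy1 _ (by omega)).symm⟩
    have hb' : v.ArrAt b := hb.congr (hy1 b (by omega)).symm
    rcases lt_or_ge d b with hdb | hdb
    · rcases (hv3 b hdb.le hb'.ne_none).1 hb' with h | h
      · omega
      · exact (h.2 a hac hab ha').congr_of_ge hac hvc hy1
    · obtain ⟨x, hx, hs⟩ := hin a b hac hab hdb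
        (ha'.imp_right fun h => ⟨h.1, h.2.congr (hv1 _ (by omega)).symm⟩) (by
          rcases hdb.eq_or_lt with rfl | hlt
          · exact Or.inl ⟨rfl, hεd.1 hb⟩
          · exact Or.inr ⟨hlt, hb'.congr (hv1 _ hlt).symm⟩)
      exact ⟨x, hx, (hseg a b x hac hdb).1 hs⟩
  refine ⟨y, ?_, hyw, hseg, fun h => ⟨hεc.2 h, hεd.2 h⟩, fun h => ⟨?_, ?_⟩, hfac, ?_⟩
  · refine fun k hk => ⟨hy2 k hk, ?_⟩
    rcases lt_or_ge c k with h | h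
    · have hkv : B.Cut v k := hk.congr (hk.1.imp
        (fun hn => ⟨(hy1 _ (by omega)).symm, hn⟩) (fun hn => ⟨(hy1 _ h.le).symm, hn⟩))
      rw [hy1 k h.le]
      exact hv2 k hkv
    · exact y.letter_ne_none (hy2 k hk) hyc (by omega) h
  · exact (Word.arrAt_or_invAt hyc').resolve_right fun h' => h (hεc.1 h')
  · exact (Word.arrAt_or_invAt hyd).resolve_left fun h' => h (hεd.1 h')
  · intro a b ha hb hor hs
    have hab : a ≤ b := by
      obtain ⟨_, _, hs⟩ := hs
      exact hs.1
    rcases hor with hac | hdb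
    · have hn : ¬ R₂ y a := fun h => ha.not_invAt ((hy3 a hac.le ha.ne_none).2 h)
      refine hn (Or.inr ⟨by omega, fun b' hab' hb' => ?_⟩)
      rcases lt_trichotomy b' b with h | rfl | h
      · exact hs.factor hT le_rfl hab' h.le (Or.inl rfl) (Or.inr hb'.factorRight)
      · exact absurd hb hb'.not_invAt
      · refine hs.extension_inv hT hb (hfac (b + 1) b' h ?_ hb')
        rwa [add_sub_cancel_right]
    · have hb' : v.InvAt b := hb.congr (hy1 b (by omega)).symm
      have hn : ¬ R₁ v b := fun h => ((hv3 b hdb.le hb'.ne_none).2 h).not_invAt hb'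
      refine hn (Or.inr ⟨by omega, fun a' hca' hab' ha' => ?_⟩)
      refine SegIn.congr_of_ge (w := y) ?_ hca' hyc fun j hj => (hy1 j hj).symm
      have hi : y.InvAt (a' - 1) := by
        rcases ha' with ⟨rfl, h⟩ | ⟨h1, h2⟩
        · exact hεc.2 h
        · exact h2.congr (hy1 _ (by omega))
      rcases lt_trichotomy a' a with h | rfl | h
      · refine (hfac a' (a - 1) (by omega) hi ha).extension hT ha ?_
        rwa [sub_add_cancel]
      · exact absurd hi ha.not_invAt
      · exact hs.factor hT h.le hab' le_rfl (Or.inr hi.factorLeft) (Or.inl rfl)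

end Blossoming

/-! ### The bijection -/

namespace Blossoming

variable {V : Type u₁} {A : Type u₂} {V' : Type u₃} {A' : Type u₄}
  {Q : GentleQuiver V A} {Q' : GentleQuiver V' A'} {B : Blossoming Q Q'} {T : Set (Str Q')}

/-- Every confined string occurs in some word with adjacent letters on both sides. -/
theorem exists_word_seg {t : Str Q'} (ht : B.IsConfined t) : ∃ (w : Word Q') (a b : ℤ),
    B.Seg w a b t ∧ w.letter (a - 1) ≠ none ∧ w.letter b ≠ none := by
  obtain ⟨γ, rfl, -⟩ := id ht
  cases γ with
  | stat q r h =>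
    let w : Word Q' :=
      { letter := fun i => if i = 0 then some (Letter.arr q) else
          if i = 1 then some (Letter.arr r) else none
        nonempty := ⟨0, by simp⟩
        interval := by
          refine ⟨fun i hi k hk j hj => ?_⟩
          have key : ∀ i : ℤ, (if i = 0 then some (Letter.arr q) else
              if i = 1 then some (Letter.arr r) else none) ≠ none ↔ 0 ≤ i ∧ i ≤ 1 := by
            intro i
            split_ifs with h1 h2
            · simp [h1]
            · simp [h2]
            · simp only [ne_eq, not_true_eq_false, false_iff]
              omega
          have h1 := (key i).1 hi
          have h2 := (key k).1 hk
          exact (key j).2 ⟨h1.1.trans hj.1, hj.2.trans h2.2⟩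
        nonzero := by
          intro i α β hα hβ
          split_ifs at hα hβ
          all_goals first
            | omega
            | (cases hα; cases hβ; exact h) }
    have h0 : w.letter (1 - 1) = some (Letter.arr q) := by simp [w]
    have h1 : w.letter 1 = some (Letter.arr r) := by simp [w]
    refine ⟨w, 1, 1, (seg_self_iff (B.cut_of_ne_none (by rw [h0]; simp) (by rw [h1]; simp))).2
      ⟨q, r, h, rfl, ?_, ?_⟩, by rw [h0]; simp, by rw [h1]; simp⟩
    · intro α hα
      rw [h0] at hα
      cases hα
      exact h
    · intro β hβ
      rw [h1] at hβ
      cases hβ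
      exact h
  | word w =>
    obtain ⟨a, b, hab, ha, hb, ha', hb'⟩ := exists_cuts_of_isConfined ht
    have hs := seg_of_eq_none hab ha hb ha' hb'
    have hwb : w.letter (b - 1) ≠ none := ha.letter_ne_none hb (by omega) (by omega)
    obtain ⟨v, hv1, hv2, -⟩ := B.exists_extension_right w b hwb (fun _ _ => False) (by simp)
    have hs' := hs.congr_of_lt le_rfl hwb hv1
    have hvb := hv2 b hs'.2.2.1
    have hva : v.letter a ≠ none := hs'.2.1.letter_ne_none hs'.2.2.1 le_rfl hab
    obtain ⟨y, hy1, hy2, -⟩ := B.exists_extension_left v a hva (fun _ _ => False) (by simp)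
    have hs'' := hs'.congr_of_ge le_rfl hva hy1
    exact ⟨y, a, b, hs'', hy2 a hs''.2.1, by rwa [hy1 b hab.le]⟩

/-- Every string in `T` is an inner factor of an infinite string in `L(T)`. -/
theorem exists_mem_lift_innerFactor (hT : B.IsTorsionSet T) {t : Str Q'} (ht : t ∈ T)
    (hc : B.IsConfined t) : ∃ x ∈ B.lift T, B.IsInfinite x ∧ B.InnerFactor x t := by
  obtain ⟨w, a, b, hs, ha, hb⟩ := exists_word_seg hc
  obtain ⟨y, h1, -, h3, h4, -, h6, -⟩ := exists_completion hT w hs.1 ha hb True (by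
    intro a' b' h1 h2 h3 h4 h5
    exact SegIn.factor hT ⟨t, ht, hs⟩ h1 h2 h3
      (h4.imp And.left fun h => h.2.factorLeft) (h5.imp And.left fun h => h.2.factorRight))
  refine ⟨(Walk.word y).str, ?_, isInfinite_iff.2 h1,
    ⟨y, a, b, rfl, (h3 a b t le_rfl le_rfl).1 hs, h4 trivial⟩⟩
  rw [mem_lift_iff_of_isInfinite (isInfinite_iff.2 h1)]
  intro s hs'
  obtain ⟨a', b', h7, h8, h9⟩ := innerFactor_str_iff.1 hs'
  exact (h6 a' b' h7.1 h8 h9).mem h7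

/-- An infinite string lies in `G(T)` if and only if its inner factors belong to `T` and its inner
subobjects do not. -/
theorem mem_gen_iff (hT : B.IsTorsionSet T) {x : Str Q'} :
    x ∈ B.gen T ↔ B.IsInfinite x ∧ (∀ t, B.InnerFactor x t → t ∈ T) ∧
      ∀ t, B.InnerSub x t → t ∉ T := by
  constructor
  · rintro ⟨h1, h2, h3⟩
    refine ⟨h2, (mem_lift_iff_of_isInfinite h2).1 h1, fun t ht ht' => ?_⟩
    obtain ⟨y, hy, -, hyt⟩ := exists_mem_lift_innerFactor hT ht' ht.isConfined
    exact h3 y hy (B.posCross_iff.2 ⟨t, hyt, ht⟩)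
  · rintro ⟨h1, h2, h3⟩
    refine ⟨(mem_lift_iff_of_isInfinite h1).2 h2, h1, fun y hy hyx => ?_⟩
    obtain ⟨t, ht, ht'⟩ := B.posCross_iff.1 hyx
    exact h3 t ht' (hy ⟨ht.isFactor, ht.isConfined⟩)

theorem str_mem_gen (hT : B.IsTorsionSet T) {w : Word Q'} (hw : B.InfWord w)
    (h1 : B.AllFactorsIn T w) (h2 : ∀ a b, w.ArrAt (a - 1) → w.InvAt b → ¬ B.SegIn T w a b) :
    (Walk.word w).str ∈ B.gen T := by
  refine (mem_gen_iff hT).2 ⟨isInfinite_iff.2 hw, fun t ht => ?_, fun t ht ht' => ?_⟩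
  · obtain ⟨a, b, h3, h4, h5⟩ := innerFactor_str_iff.1 ht
    exact (h1 a b h3.1 h4 h5).mem h3
  · obtain ⟨a, b, h3, h4, h5⟩ := innerSub_str_iff.1 ht
    exact h2 a b h4 h5 ⟨t, ht', h3⟩

theorem exists_shortest {P : ℤ → ℤ → Prop} (h : ∃ a b, a ≤ b ∧ P a b) :
    ∃ c d, c ≤ d ∧ P c d ∧ ∀ a b, a ≤ b → b - a < d - c → ¬ P a b := by
  classical
  have h' : ∃ n : ℕ, ∃ a b, a ≤ b ∧ P a b ∧ (b - a).toNat = n := by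
    obtain ⟨a, b, h1, h2⟩ := h
    exact ⟨_, a, b, h1, h2, rfl⟩
  obtain ⟨c, d, h1, h2, h3⟩ := Nat.find_spec h'
  refine ⟨c, d, h1, h2, fun a b hab hlt hP => ?_⟩
  exact Nat.find_min h' (m := (b - a).toNat) (by omega) ⟨a, b, hab, hP, rfl⟩

/-- An infinite string outside `L(T)` has a positive crossing to some string in `G(T)`: a shortest
factor `ω` outside `T` has no subobject in `T`, and hence can be completed to a string in
`G(T)` of which it is a subobject. -/
theorem exists_posCross_gen (hT : B.IsTorsionSet T) {x : Str Q'} (hx : B.IsInfinite x)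
    (h : x ∉ B.lift T) : ∃ y ∈ B.gen T, x.PosCross y := by
  obtain ⟨w, rfl, hw⟩ := exists_infWord hx
  rw [mem_lift_iff_of_isInfinite hx] at h
  push Not at h
  obtain ⟨t, ht, htT⟩ := h
  obtain ⟨a₀, b₀, hs, h1, h2⟩ := innerFactor_str_iff.1 ht
  obtain ⟨c, d, hcd, ⟨hc, hd, hn⟩, hmin⟩ := exists_shortest
    (P := fun a b => w.InvAt (a - 1) ∧ w.ArrAt b ∧ ¬ B.SegIn T w a b)
    ⟨a₀, b₀, hs.1, h1, h2, fun h => htT (h.mem hs)⟩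
  have hmin' : ∀ a b, a ≤ b → b - a < d - c → w.InvAt (a - 1) → w.ArrAt b → B.SegIn T w a b :=
    fun a b h1 h2 h3 h4 => by_contra fun h => hmin a b h1 h2 ⟨h3, h4, h⟩
  obtain ⟨y, hy, hyw, hseg, -, hb, hfac, hsub⟩ :=
    exists_completion hT w hcd hc.ne_none hd.ne_none False (by
      rintro a b h1 h2 h3 (⟨-, h4⟩ | h4) (⟨-, h5⟩ | h5)
      · exact h4.elim
      · exact h4.elim
      · exact h5.elim
      · exact hmin' a b h2 (by omega) h4.2 h5.2)
  obtain ⟨hyc, hyd⟩ := hb id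
  obtain ⟨s, hs⟩ := exists_seg hcd (B.cut_of_ne_none hc.ne_none
    (w.letter_ne_none hc.ne_none hd.ne_none (by omega) hcd)) (B.cut_of_ne_none
    (w.letter_ne_none hc.ne_none hd.ne_none (by omega) (by omega)) hd.ne_none)
  refine ⟨(Walk.word y).str, str_mem_gen hT hy hfac fun a b ha hb hab => ?_,
    B.posCross_iff.2 ⟨s, ⟨w, c, d, rfl, hs, hc, hd⟩,
      ⟨y, c, d, rfl, (hseg c d s le_rfl le_rfl).1 hs, hyc, hyd⟩⟩⟩
  by_cases hor : a < c ∨ d < b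
  · exact hsub a b ha hb hor hab
  obtain ⟨u, hu, hus⟩ := hab
  have hab := hus.1
  have hca : c ≤ a := by omega
  have hbd : b ≤ d := by omega
  have h1 : B.SegIn T w a b := ⟨u, hu, (hseg a b u hca hbd).2 hus⟩
  -- the parts of the shortest factor on both sides of a subobject are shorter factors
  have h2 : B.SegIn T w a d := by
    rcases hbd.eq_or_lt with rfl | hlt
    · exact h1
    · have hb' : w.InvAt b := hb.congr (hyw b (by omega) hlt).symm
      refine h1.extension_inv hT hb' (hmin' (b + 1) d hlt (by omega) ?_ hd)
      rwa [add_sub_cancel_right]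
  refine hn ?_
  rcases hca.eq_or_lt with rfl | hlt
  · exact h2
  · have ha' : w.ArrAt (a - 1) := ha.congr (hyw (a - 1) (by omega) (by omega)).symm
    refine (hmin' c (a - 1) (by omega) (by omega) hc ha').extension hT ha' ?_
    rwa [sub_add_cancel]

/-- If a string in `L(T)` has a positive crossing to the infinite string `x`, then so does a string
in `G(T)`: it suffices to complete a shortest subobject of `x` in `T`. -/
theorem exists_gen_posCross (hT : B.IsTorsionSet T) {x t : Str Q'} (hx : B.IsInfinite x)
    (hxL : x ∈ B.lift T) (ht : B.InnerSub x t) (htT : t ∈ T) : ∃ y ∈ B.gen T, y.PosCross x := by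
  obtain ⟨w, rfl, hw⟩ := exists_infWord hx
  obtain ⟨a₀, b₀, hs, h1, h2⟩ := innerSub_str_iff.1 ht
  obtain ⟨c, d, hcd, ⟨hc, hd, hn⟩, hmin⟩ := exists_shortest
    (P := fun a b => w.ArrAt (a - 1) ∧ w.InvAt b ∧ B.SegIn T w a b)
    ⟨a₀, b₀, hs.1, h1, h2, t, htT, hs⟩
  obtain ⟨y, hy, hyw, hseg, hb, -, hfac, hsub⟩ :=
    exists_completion hT w hcd hc.ne_none hd.ne_none True (by
      intro a b h1 h2 h3 h4 h5
      exact hn.factor hT h1 h2 h3 (h4.imp And.left fun h => h.2.factorLeft)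
        (h5.imp And.left fun h => h.2.factorRight))
  obtain ⟨hyc, hyd⟩ := hb trivial
  obtain ⟨s, -, hs⟩ := hn
  refine ⟨(Walk.word y).str, str_mem_gen hT hy hfac fun a b ha hbi hab => ?_,
    B.posCross_iff.2 ⟨s, ⟨y, c, d, rfl, (hseg c d s le_rfl le_rfl).1 hs, hyc, hyd⟩,
      ⟨w, c, d, rfl, hs, hc, hd⟩⟩⟩
  by_cases hor : a < c ∨ d < b
  · exact hsub a b ha hbi hor hab
  have hac : a ≠ c := by
    rintro rfl
    exact ha.not_invAt hyc
  have hbd : b ≠ d := by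
    rintro rfl
    exact hyd.not_invAt hbi
  obtain ⟨u, hu, hus⟩ := hab
  have hab := hus.1
  exact hmin a b hab (by omega) ⟨ha.congr (hyw _ (by omega) (by omega)).symm,
    hbi.congr (hyw _ (by omega) (by omega)).symm, u, hu, (hseg a b u (by omega) (by omega)).2 hus⟩

theorem gen_mem_maxNC (hT : B.IsTorsionSet T) : B.gen T ∈ B.maxNC := by
  refine ⟨⟨fun x hx => hx.2.1, fun x hx y hy => hy.2.2 x hx.1⟩, fun S hS hle x hx => ?_⟩
  have hxL : x ∈ B.lift T := by
    by_contra h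
    obtain ⟨y, hy, hxy⟩ := exists_posCross_gen hT (hS.1 x hx) h
    exact hS.2 x hx y (hle hy) hxy
  refine (mem_gen_iff hT).2 ⟨hS.1 x hx, (mem_lift_iff_of_isInfinite (hS.1 x hx)).1 hxL,
    fun t ht htT => ?_⟩
  obtain ⟨y, hy, hyx⟩ := exists_gen_posCross hT (hS.1 x hx) hxL ht htT
  exact hS.2 y (hle hy) x hx hyx

/-- `T(G(T)) = T`: for the torsion set `T'` generated by `G(T)` one has `G(T) = G(T')` by
maximality. A string in `T` but not in `T'` would give a string in `L(T)` outside `L(T')`, and this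
would have a positive crossing to a string in `G(T') = G(T)`. -/
theorem torsGen_gen (hT : T ∈ B.tors) : B.torsGen (B.gen T) = T := by
  have hle : B.torsGen (B.gen T) ⊆ T := (torsGen_subset_iff hT.1).2 fun x hx => hx.1
  refine hle.antisymm fun t ht => ?_
  by_contra hn
  have hT' := (B.torsGen_mem_tors (B.gen T)).1
  obtain ⟨x, hx, hxi, hxt⟩ := exists_mem_lift_innerFactor hT.1 ht (hT.2 t ht)
  obtain ⟨y, hy, hxy⟩ := exists_posCross_gen hT' hxi
    (fun h => hn ((mem_lift_iff_of_isInfinite hxi).1 h t hxt))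
  have hgen : B.gen T ⊆ B.gen (B.torsGen (B.gen T)) := by
    intro z hz
    refine ⟨(torsGen_subset_iff hT').1 le_rfl hz, hz.2.1, fun u hu => hz.2.2 u ?_⟩
    exact fun s hs => hle (hu hs)
  have hmax := (gen_mem_maxNC hT.1).2 (gen_mem_maxNC hT').1 hgen
  exact (hmax hy).2.2 x hx hxy

/-- `G(T(S)) = S`: for `x ∈ S` the strings in `S` have no inner factors that are inner subobjects of
`x`, and hence this holds for all strings generated by `S`. -/
theorem gen_torsGen {S : Set (Str Q')} (hS : S ∈ B.maxNC) : B.gen (B.torsGen S) = S := by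
  have hT := (B.torsGen_mem_tors S).1
  have hle : S ⊆ B.gen (B.torsGen S) := by
    intro x hx
    have hxi := hS.1.1 x hx
    refine (mem_gen_iff hT).2 ⟨hxi, (mem_lift_iff_of_isInfinite hxi).1
      ((torsGen_subset_iff hT).1 le_rfl hx), fun t ht htT => ?_⟩
    have hsub : B.torsGen S ⊆ B.subFree x := by
      refine (torsGen_subset_iff (B.subFree_mem_tors x).1).2 fun y hy => ?_
      rw [mem_lift_iff_of_isInfinite (hS.1.1 y hy)]
      refine fun s hs => ⟨hs.isConfined, fun u hu hxu => ?_⟩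
      have hyu := (hS.1.1 y hy).innerFactor hxu.isConfined
        (isFactor_trans hxu.isConfined hu hs.isFactor)
      exact hS.1.2 y hy x hx (B.posCross_iff.2 ⟨u, hyu, hxu⟩)
    exact (hsub htT).2 t (Or.inl rfl) ht
  exact (hS.2 (gen_mem_maxNC hT).1 hle).antisymm hle

end Blossoming

theorem mainTheorem2 {V : Type u₁} {A : Type u₂} {V' : Type u₃} {A' : Type u₄}
    (Q : GentleQuiver V A) (Q' : GentleQuiver V' A') (B : Blossoming Q Q') :
    ∃ e : B.maxNC ≃ B.tors,
      (∀ S : B.maxNC, ((e S : B.tors) : Set (Str Q')) = B.torsGen S) ∧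
      (∀ T : B.tors, ((e.symm T : B.maxNC) : Set (Str Q')) = B.gen T) ∧
      (∀ S S' : B.maxNC, ((e S' : B.tors) : Set (Str Q')) ⊆ (e S : B.tors) ↔
        ∀ x ∈ (S' : Set (Str Q')), ∀ y ∈ (S : Set (Str Q')), ¬ x.PosCross y) := by
  refine ⟨{ toFun := fun S => ⟨B.torsGen S, B.torsGen_mem_tors S⟩
            invFun := fun T => ⟨B.gen T, Blossoming.gen_mem_maxNC T.2.1⟩
            left_inv := fun S => Subtype.ext (Blossoming.gen_torsGen S.2)
            right_inv := fun T => Subtype.ext (Blossoming.torsGen_gen T.2) },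
    fun _ => rfl, fun _ => rfl, fun S S' => ?_⟩
  have hT := (B.torsGen_mem_tors (S : Set (Str Q'))).1
  have hS : B.gen (B.torsGen S) = S := Blossoming.gen_torsGen S.2
  refine (Blossoming.torsGen_subset_iff hT).trans ⟨fun h x hx y hy => ?_, fun h x hx => ?_⟩
  · rw [← hS] at hy
    exact hy.2.2 x (h hx)
  · by_contra hn
    obtain ⟨y, hy, hxy⟩ := Blossoming.exists_posCross_gen hT (S'.2.1.1 x hx) hn
    rw [hS] at hy
    exact h x hx y hy hxy
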